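/- **Theorem (Consistency of the Linearized Bregman ISS).** Let $n\ge 2$, $X=[X_1,\dots,X_p]\in\mathbb R^{n\times p}$, $\beta^*\in\mathbb R^p\setminus\{0\}$, $\sigma>0$, and $y=X\beta^*+\epsilon$ with $\epsilon\sim\mathcal N(0,\sigma^2 I_n)$. Let $S=\mathrm{supp}(\beta^*)$, $s=|S|$, $T=S^c$, $\beta^*_{\max}=\max_{i\in S}|\beta^*_i|$, $\beta^*_{\min}=\min_{i\in S}|\beta^*_i|$, let $X_S,X_T$ be the column submatrices of $X$, and put $X_S^*=\frac1nX_S^T$, $X_T^*=\frac1nX_T^T$ and $\|u\|_n=\|u\|_2/\sqrt n$. For matrices, $\|\cdot\|_\infty$ denotes the maximal absolute row sum. Write $M=\max_{j\in T}\|X_j\|_n$ and assume that $T\neq\emptyset$ and $M>0$. For $\kappa>0$, an LBISS path is a pair $(\rho_t,\beta_t)_{t\ge0}$ of continuous $\mathbb R^p$-valued functions with $\rho_0=\beta_0=0$, both right differentiable on $[0,\infty)$, $\rho$ with right continuous right derivative, such that for all $t\ge 0$ (dots being right derivatives) $$\dot\rho_t+\tfrac1\kappa\dot\beta_t=\tfrac1nX^T(y-X\beta_t),\qquad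 \rho_t\in\partial\|\beta_t\|_1 .$$ Its mean path is $\bar\beta_t=\frac1t\int_0^t\beta_r\,dr$ for $t>0$. Assume - (A1) $X_S^*X_S\succeq\gamma I$ for some $\gamma\in(0,1]$; - (A2) $\|X_T^*X_S(X_S^*X_S)^{-1}\|_\infty\le 1-\eta$ for some $\eta\in(0,1)$; - $\kappa$ is large enough that $$B:=\beta^*_{\max}+2\sigma\sqrt{\frac{\log p}{\gamma n}}+\frac{\|X\beta^*\|_2+2\sigma\sqrt{s\log n}}{\sqrt{n\gamma}}\le\kappa\eta .$$ Put $$\bar\tau=\frac{(1-B/(\kappa\eta))\,\eta}{2\sigma}\sqrt{\frac n{\log p}}\;M^{-1},\qquad c_1=\frac{(1-B/(\kappa\eta))\,\eta}{\sqrt\gamma\,M}+\Big(1+\frac B{\kappa\eta}\Big)\big\|(X_S^*X_S)^{-1}\big\|_\infty .$$ Then for every realization of $\epsilon$ an LBISS path exists, and there is an event of probability at least $$1-\frac2{p\sqrt{\pi\log p}}-\frac1{n\sqrt{\pi\log n}}$$ on which every LBISS path satisfies all of the following. - A. (No false positives) $\mathrm{supp}(\beta_t)\subseteq S$ for all $0\le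 t\le\bar\tau$. - B. (Sign consistency of the mean path) If $\bar\tau>0$ and $\beta^*_{\min}>c_1/\bar\tau$, then $\mathrm{sign}(\bar\beta_{\bar\tau})=\mathrm{sign}(\beta^*)$. - C. (Sign consistency) If $$\beta^*_{\min}\ge\frac{4\sigma}{\sqrt\gamma}\sqrt{\frac{\log p}n}\quad\text{and}\quad\frac{8+4\log s}{\gamma\beta^*_{\min}}+\frac1{\kappa\gamma}\log\frac{3\|\beta^*\|_2}{\beta^*_{\min}}\le\bar\tau,$$ then $\mathrm{sign}(\beta_{\bar\tau})=\mathrm{sign}(\beta^*)$. - D. ($\ell_2$ bound) For every $C>0$ with $$\frac4{C\gamma}\sqrt{\frac n{\log p}}+\frac1{2\kappa\gamma}\Big(1+\log\frac{n\|\beta^*\|_2^2+4\sigma^2s\log p/\gamma}{C^2s\log p}\Big)\le\bar\tau,$$ there is $\tau\in[0,\bar\tau]$ (possibly depending on the realization of $\epsilon$) with $$\|\beta_\tau-\beta^*\|_2\le\Big(C+\frac{2\sigma}{\sqrt\gamma}\Big)\sqrt{\frac{s\log p}n}.$$ -/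

import Mathlib

open MeasureTheory ProbabilityTheory Set
open scoped Matrix

namespace LBISS

/-- The support of a vector. -/
noncomputable def supp {p : ℕ} (b : Fin p → ℝ) : Finset (Fin p) :=
  Finset.univ.filter fun i => b i ≠ 0

/-- The `ℓ₁` norm of a vector. -/
noncomputable def l1norm {ι : Type*} [Fintype ι] (v : ι → ℝ) : ℝ := ∑ i, |v i|

/-- The Euclidean norm of a vector. -/
noncomputable def l2norm {ι : Type*} [Fintype ι] (v : ι → ℝ) : ℝ := ‖WithLp.toLp 2 v‖

/-- The matrix norm `‖M‖_∞`, i.e. the largest absolute row sum. -/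
noncomputable def matInfNorm {ι₁ ι₂ : Type*} [Fintype ι₁] [Fintype ι₂]
    (M : Matrix ι₁ ι₂ ℝ) : ℝ :=
  letI := Matrix.linftyOpNormedAddCommGroup (m := ι₁) (n := ι₂) (α := ℝ)
  ‖M‖

/-- The subdifferential at `x` of a (convex) function `f` on `ℝᵖ`. -/
def subdifferential {p : ℕ} (f : (Fin p → ℝ) → ℝ) (x : Fin p → ℝ) : Set (Fin p → ℝ) :=
  {g | ∀ z, f x + g ⬝ᵥ (z - x) ≤ f z}

/-- The submatrix formed by the columns of `X` with index in `A`. -/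
def cols {n p : ℕ} (X : Matrix (Fin n) (Fin p) ℝ) (A : Finset (Fin p)) :
    Matrix (Fin n) A ℝ :=
  X.submatrix id fun i : A => (i : Fin p)

/-- The adjoint `X* = (1/n) Xᵀ` of a matrix with `n` rows, for `⟨u, v⟩ₙ = uᵀ v / n`. -/
noncomputable def adj {n : ℕ} {ι : Type*} (X : Matrix (Fin n) ι ℝ) : Matrix ι (Fin n) ℝ :=
  (1 / (n : ℝ)) • Xᵀ

/-- The Gram matrix `X_A* X_A`. -/
noncomputable def gram {n p : ℕ} (X : Matrix (Fin n) (Fin p) ℝ) (A : Finset (Fin p)) :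
    Matrix A A ℝ :=
  adj (cols X A) * cols X A

/-- Restricted strong convexity with constant `γ ∈ (0, 1]`: `X_S* X_S ≥ γ I`. -/
def RestrictedStrongConvexity {n p : ℕ} (X : Matrix (Fin n) (Fin p) ℝ) (S : Finset (Fin p))
    (γ : ℝ) : Prop :=
  0 < γ ∧ γ ≤ 1 ∧ (gram X S - γ • (1 : Matrix S S ℝ)).PosSemidef

/-- The irrepresentable condition with constant `η ∈ (0, 1)`:
`‖X_T* X_S (X_S* X_S)⁻¹‖_∞ ≤ 1 - η`, where `T` is the complement of `S`. -/
def Irrepresentable {n p : ℕ} (X : Matrix (Fin n) (Fin p) ℝ) (S : Finset (Fin p))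
    (η : ℝ) : Prop :=
  0 < η ∧ η < 1 ∧ matInfNorm (adj (cols X Sᶜ) * cols X S * (gram X S)⁻¹) ≤ 1 - η

/-- The largest magnitude of a nonzero entry of `b`. -/
noncomputable def maxMag {p : ℕ} (b : Fin p → ℝ) : ℝ := ⨆ i : supp b, |b i|

/-- The smallest magnitude of a nonzero entry of `b`. -/
noncomputable def minMag {p : ℕ} (b : Fin p → ℝ) : ℝ := ⨅ i : supp b, |b i|

/-- `max_{j ∈ T} ‖X_j‖ₙ`, where `T` is the complement of the support of `b`
and `‖u‖ₙ = ‖u‖₂ / √n`. -/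
noncomputable def maxOffCol {n p : ℕ} (X : Matrix (Fin n) (Fin p) ℝ) (b : Fin p → ℝ) : ℝ :=
  ⨆ j : ((supp b)ᶜ : Finset (Fin p)), l2norm (fun i => X i j) / √(n : ℝ)

/-- The constant `B`, where `b` is the true signal. -/
noncomputable def constB {n p : ℕ} (X : Matrix (Fin n) (Fin p) ℝ) (b : Fin p → ℝ)
    (σ γ : ℝ) : ℝ :=
  maxMag b + 2 * σ * √(Real.log p / (γ * n))
    + (l2norm (X *ᵥ b) + 2 * σ * √((supp b).card * Real.log n)) / √(n * γ)

/-- The stopping time `τ̄`, where `b` is the true signal. -/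
noncomputable def tauBar {n p : ℕ} (X : Matrix (Fin n) (Fin p) ℝ) (b : Fin p → ℝ)
    (σ γ η κ : ℝ) : ℝ :=
  (1 - constB X b σ γ / (κ * η)) * η / (2 * σ) * √(n / Real.log p) * (maxOffCol X b)⁻¹

/-- The constant `c₁` of the strong-signal condition for the mean path. -/
noncomputable def constC1 {n p : ℕ} (X : Matrix (Fin n) (Fin p) ℝ) (b : Fin p → ℝ)
    (σ γ η κ : ℝ) : ℝ :=
  (1 - constB X b σ γ / (κ * η)) * η / (√γ * maxOffCol X b)
    + (1 + constB X b σ γ / (κ * η)) * matInfNorm ((gram X (supp b))⁻¹)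

/-- `(ρ, β)` is a solution path on `[0, ∞)`, started at `(0, 0)`, of the Linearized Bregman
inverse scale space `ρ̇ + β̇ / κ = (1/n) Xᵀ (y - X β)`, `ρ ∈ ∂‖β‖₁`. Dots are right derivatives. -/
structure IsPath {n p : ℕ} (X : Matrix (Fin n) (Fin p) ℝ) (y : Fin n → ℝ) (κ : ℝ)
    (ρ β : ℝ → Fin p → ℝ) : Prop where
  rho_zero : ρ 0 = 0
  beta_zero : β 0 = 0
  rho_continuous : ContinuousOn ρ (Ici 0)
  beta_continuous : ContinuousOn β (Ici 0)
  subgradient : ∀ t, 0 ≤ t → ρ t ∈ subdifferential l1norm (β t)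
  evolution : ∃ ρ' β' : ℝ → Fin p → ℝ, ∀ t, 0 ≤ t →
    HasDerivWithinAt ρ (ρ' t) (Ici t) t ∧
    ContinuousWithinAt ρ' (Ici t) t ∧
    HasDerivWithinAt β (β' t) (Ici t) t ∧
    ρ' t + (1 / κ) • β' t = adj X *ᵥ (y - X *ᵥ β t)

/-- The mean path `β̄(t) = (1/t) ∫₀ᵗ β(s) ds`. -/
noncomputable def meanPath {p : ℕ} (β : ℝ → Fin p → ℝ) (t : ℝ) : Fin p → ℝ :=
  (1 / t) • ∫ s in (0 : ℝ)..t, β s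

/-- Equality of the componentwise signs in `{-1, 0, 1}`. -/
def SameSign {p : ℕ} (a b : Fin p → ℝ) : Prop :=
  ∀ i, SignType.sign (a i) = SignType.sign (b i)

end LBISS

open LBISS

/-! Put z = ρ + β/κ. The condition ρ ∈ ∂‖β‖₁ says coordinatewise that β = κ·shrink(z) and ρ = z -
shrink(z). Paths therefore correspond to solutions of the Lipschitz equation z' = X*(y - Xβ), z(0) =
0, with β = κ·shrink(z). This gives existence (`exists_isPath`) and, through `IsPath.isFlowOn` and
`IsFlowOn.eqOn`, uniqueness.

Let H = X_S*X_S and let w be β* on S plus the least squares coefficients of the noise (`oracle`).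
The equation on S alone is z' = H(w - β). Its solution extends off S by X_T*X_S H⁻¹ z(t) + t X_T*r,
where r is the least squares residual of the noise. While this extension stays in [-1, 1], its
coordinates are thresholded to zero, so it solves the full equation and carries every path
(`IsPath.eq_restricted`). The H-energy of β - w never increases (`IsFlowOn.energy_le`), hence |β_i|
≤ B and |z_i| ≤ 1 + B/κ on S. The irrepresentable condition and the bound on X_T*r then keep the
extension in [-1, 1] up to τ̄, which is A. Integrating the restricted equation gives the mean path
as w - H⁻¹z(t)/t, and B follows.

For C and D let x = ‖β - w‖² and let Φ be the Bregman divergence to w plus x/(2κ). Then Φ' ≤ -γx.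
Conversely Φ is at most an increasing function F of x: of square root type in general, linear when
the entries of w are bounded below. `le_of_dissipation` turns this into an explicit time for Φ to
fall from F(v₀) to F(v₁). If x were still large after that, dissipation at constant rate would push
Φ below its lower bound x/(2κ).

The noise enters only through linear functionals: one for each of the p coordinates, and at most
min(|S|, n) for the fitted noise. Gaussian tails at two standard deviations times √log p or √log n,
with union bounds, give the probability. -/

namespace LBISS

open Filter
open scoped Topology NNReal

/-! ### Global solutions of Lipschitz differential equations -/

/-- Coordinatewise truncation to `[-R, R]`. -/
noncomputable def truncate {ι : Type*} (R : ℝ) (x : ι → ℝ) : ι → ℝ :=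
  fun i => max (-R) (min R (x i))

lemma lipschitzWith_truncate {ι : Type*} [Fintype ι] (R : ℝ) :
    LipschitzWith 1 (truncate (ι := ι) R) := by
  refine LipschitzWith.of_dist_le_mul fun x y => ?_
  rw [NNReal.coe_one, one_mul, dist_pi_le_iff dist_nonneg]
  intro i
  refine le_trans ?_ (dist_le_pi_dist x y i)
  simp only [truncate, Real.dist_eq]
  rw [max_comm (-R), max_comm (-R), min_comm R, min_comm R]
  exact (abs_max_sub_max_le_abs _ _ _).trans (abs_inf_sub_inf_le_abs (x i) (y i) R)

lemma norm_truncate_le {ι : Type*} [Fintype ι] {R : ℝ} (hR : 0 ≤ R) (x : ι → ℝ) :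
    ‖truncate R x‖ ≤ R := by
  rw [pi_norm_le_iff_of_nonneg hR]
  intro i
  rw [Real.norm_eq_abs, abs_le, truncate]
  exact ⟨le_max_left _ _, max_le (by linarith) (min_le_left _ _)⟩

lemma norm_truncate_le_norm {ι : Type*} [Fintype ι] {R : ℝ} (hR : 0 ≤ R) (x : ι → ℝ) :
    ‖truncate R x‖ ≤ ‖x‖ := by
  have h0 : truncate R (0 : ι → ℝ) = 0 := by
    funext i
    simp [truncate, hR]
  have := (lipschitzWith_truncate R).dist_le_mul x 0
  simpa [h0] using this

lemma truncate_eq_self {ι : Type*} [Fintype ι] {R : ℝ} {x : ι → ℝ} (hx : ‖x‖ ≤ R) :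
    truncate R x = x := by
  funext i
  have := abs_le.1 ((norm_le_pi_norm x i).trans hx)
  rw [truncate, min_eq_right this.2, max_eq_right this.1]

/-- Truncating the argument makes the field bounded, so Picard-Lindelöf reaches T in one step.
Grönwall then shows that the truncation was never active. -/
lemma exists_solution_Icc {ι : Type*} [Fintype ι] {F : (ι → ℝ) → ι → ℝ} {K : ℝ≥0}
    (hF : LipschitzWith K F) {T : ℝ} (hT : 0 ≤ T) :
    ∃ z : ℝ → ι → ℝ, z 0 = 0 ∧ ∀ t ∈ Icc 0 T, HasDerivWithinAt z (F (z t)) (Icc 0 T) t := by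
  have hmono : Monotone (gronwallBound 0 K ‖F 0‖) :=
    gronwallBound_mono le_rfl (norm_nonneg _) K.2
  set R : ℝ := gronwallBound 0 K ‖F 0‖ T with hRdef
  have hR : 0 ≤ R := by
    have := hmono hT
    rwa [gronwallBound_x0] at this
  have hFb : ∀ x, ‖F x‖ ≤ K * ‖x‖ + ‖F 0‖ := fun x => by
    have h1 := hF.dist_le_mul x 0
    rw [dist_zero_right, dist_eq_norm] at h1
    have h2 := norm_sub_norm_le (F x) (F 0)
    linarith
  have hG : LipschitzWith K (F ∘ truncate R) := by
    simpa using hF.comp (lipschitzWith_truncate R)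
  let L : ℝ≥0 := K * ⟨R, hR⟩ + ‖F 0‖₊
  have hpl : IsPicardLindelof (fun _ => F ∘ truncate R) (tmin := 0) (tmax := T)
      ⟨0, le_rfl, hT⟩ 0 (L * ⟨T, hT⟩) 0 L K := by
    refine IsPicardLindelof.of_time_independent ?_ hG.lipschitzOnWith ?_
    · intro x _
      refine (hFb _).trans ?_
      have := mul_le_mul_of_nonneg_left (norm_truncate_le hR x) K.2
      have hL : (L : ℝ) = K * R + ‖F 0‖ := rfl
      rw [hL]
      exact add_le_add_left this _
    · have hL : ((L * ⟨T, hT⟩ : ℝ≥0) : ℝ) = L * T := rfl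
      simp [hT, hL]
  obtain ⟨z, hz0, hz⟩ := hpl.exists_eq_forall_mem_Icc_hasDerivWithinAt₀
  refine ⟨z, hz0, fun t ht => ?_⟩
  -- Truncation does not increase the norm, so the truncated field obeys the growth bound of `F`.
  -- The resulting bound is independent of the level R, which was chosen as its value at T.
  have hbound : ∀ x ∈ Icc 0 T, ‖z x‖ ≤ gronwallBound 0 K ‖F 0‖ (x - 0) := by
    refine norm_le_gronwallBound_of_norm_deriv_right_le
      (f' := fun s => (F ∘ truncate R) (z s)) ?_ ?_ (by simp [show z 0 = 0 from hz0]) ?_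
    · exact fun s hs => (hz s hs).continuousWithinAt
    · intro s hs
      refine (hz s ⟨hs.1, hs.2.le⟩).mono_of_mem_nhdsWithin ?_
      exact mem_of_superset (Icc_mem_nhdsGE hs.2) (Icc_subset_Icc_left hs.1)
    · intro s _
      refine (hFb _).trans ?_
      have := mul_le_mul_of_nonneg_left (norm_truncate_le_norm hR (z s)) K.2
      gcongr
      exact norm_truncate_le_norm hR (z s)
  have h := hz t ht
  have htr : truncate R (z t) = z t :=
    truncate_eq_self ((hbound t ht).trans (by rw [sub_zero]; exact hmono ht.2))
  simpa [htr] using h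

lemma exists_global_solution {ι : Type*} [Fintype ι] {F : (ι → ℝ) → ι → ℝ} {K : ℝ≥0}
    (hF : LipschitzWith K F) :
    ∃ z : ℝ → ι → ℝ, z 0 = 0 ∧ ∀ t, 0 ≤ t → HasDerivWithinAt z (F (z t)) (Ici 0) t := by
  choose u hu0 hu using fun N : ℕ =>
    exists_solution_Icc hF (T := (N : ℝ) + 1) (by positivity)
  have hright : ∀ N : ℕ, ∀ t ∈ Ico (0 : ℝ) ((N : ℝ) + 1),
      HasDerivWithinAt (u N) (F (u N t)) (Ici t) t := fun N t ht =>
    (hu N t ⟨ht.1, ht.2.le⟩).mono_of_mem_nhdsWithin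
      (mem_of_superset (Icc_mem_nhdsGE ht.2) (Icc_subset_Icc_left ht.1))
  have huniq : ∀ M N : ℕ, M ≤ N → EqOn (u M) (u N) (Icc 0 ((M : ℝ) + 1)) := by
    intro M N hMN
    have hMN' : (M : ℝ) ≤ N := by exact_mod_cast hMN
    refine ODE_solution_unique_of_mem_Icc_right (K := K) (v := fun _ => F)
      (s := fun _ => univ) (fun _ _ => hF.lipschitzOnWith) ?_ (hright M)
      (fun _ _ => mem_univ _) ?_ ?_ (fun _ _ => mem_univ _) (by rw [hu0, hu0])
    · exact fun s hs => (hu M s hs).continuousWithinAt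
    · exact fun s hs => ((hu N s ⟨hs.1, by linarith [hs.2]⟩).continuousWithinAt).mono
        (Icc_subset_Icc_right (by linarith))
    · exact fun s hs => hright N s ⟨hs.1, by linarith [hs.2]⟩
  -- The solution `u N` lives up to N + 1, so `u ⌊t⌋₊` is still defined to the right of t. By
  -- uniqueness it agrees with the glued function on all of [0, ⌊t⌋ + 1).
  refine ⟨fun t => u ⌊t⌋₊ t, by simp [hu0], fun t ht => ?_⟩
  have hlt := Nat.lt_floor_add_one t
  have heq : EqOn (fun t => u ⌊t⌋₊ t) (u ⌊t⌋₊) (Ico 0 ((⌊t⌋₊ : ℝ) + 1)) := by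
    intro s hs
    have hle : ⌊s⌋₊ ≤ ⌊t⌋₊ :=
      Nat.lt_succ_iff.1 ((Nat.floor_lt hs.1).2 (by push_cast; exact hs.2))
    exact huniq _ _ hle ⟨hs.1, (Nat.lt_floor_add_one s).le⟩
  have hmem : Ico (0 : ℝ) ((⌊t⌋₊ : ℝ) + 1) ∈ 𝓝[Ici 0] t := by
    rw [← Ici_inter_Iio]
    exact inter_mem self_mem_nhdsWithin (mem_nhdsWithin_of_mem_nhds (Iio_mem_nhds hlt))
  have h1 := (hu ⌊t⌋₊ t ⟨ht, hlt.le⟩).mono_of_mem_nhdsWithin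
    (mem_of_superset hmem Ico_subset_Icc_self)
  exact h1.congr_of_eventuallyEq (mem_of_superset hmem heq) rfl

/-! ### Soft thresholding -/

/-- Soft thresholding at level one. -/
noncomputable def shrink (x : ℝ) : ℝ := max (x - 1) 0 - max (-x - 1) 0

lemma shrink_of_one_le {x : ℝ} (h : 1 ≤ x) : shrink x = x - 1 := by
  rw [shrink, max_eq_left (by linarith), max_eq_right (by linarith), sub_zero]

lemma shrink_of_le_neg_one {x : ℝ} (h : x ≤ -1) : shrink x = x + 1 := by
  rw [shrink, max_eq_right (by linarith), max_eq_left (by linarith)]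
  ring

lemma shrink_of_abs_le {x : ℝ} (h : |x| ≤ 1) : shrink x = 0 := by
  have := abs_le.1 h
  rw [shrink, max_eq_right (by linarith), max_eq_right (by linarith), sub_zero]

@[simp] lemma shrink_zero : shrink 0 = 0 := shrink_of_abs_le (by simp)

lemma shrink_cases (x : ℝ) :
    (1 ≤ x ∧ shrink x = x - 1) ∨ (x ≤ -1 ∧ shrink x = x + 1) ∨
      (-1 ≤ x ∧ x ≤ 1 ∧ shrink x = 0) := by
  rcases le_total 1 x with h | h
  · exact Or.inl ⟨h, shrink_of_one_le h⟩
  rcases le_total x (-1) with h' | h'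
  · exact Or.inr (Or.inl ⟨h', shrink_of_le_neg_one h'⟩)
  · exact Or.inr (Or.inr ⟨h', h, shrink_of_abs_le (abs_le.2 ⟨h', h⟩)⟩)

lemma abs_shrink_sub_shrink_le (x y : ℝ) : |shrink x - shrink y| ≤ |x - y| := by
  rw [abs_le]
  rcases shrink_cases x with ⟨_, h⟩ | ⟨_, h⟩ | ⟨_, _, h⟩ <;>
  rcases shrink_cases y with ⟨_, h'⟩ | ⟨_, h'⟩ | ⟨_, _, h'⟩ <;>
  rw [h, h'] <;> constructor <;>
  first
  | linarith [neg_abs_le (x - y), le_abs_self (x - y), abs_nonneg (x - y)]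

lemma continuous_shrink : Continuous shrink := by
  unfold shrink
  fun_prop

lemma abs_sub_shrink_le (x : ℝ) : |x - shrink x| ≤ 1 := by
  rw [abs_le]
  rcases shrink_cases x with ⟨_, h⟩ | ⟨_, h⟩ | ⟨_, _, h⟩ <;> rw [h] <;> constructor <;> linarith

lemma sub_shrink_mul_shrink (x : ℝ) : (x - shrink x) * shrink x = |shrink x| := by
  rcases shrink_cases x with ⟨hx, h⟩ | ⟨hx, h⟩ | ⟨_, _, h⟩ <;> rw [h]
  · rw [abs_of_nonneg (by linarith)]; ring
  · rw [abs_of_nonpos (by linarith)]; ring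
  · simp

/-- Decomposition of a point into a sign-compatible pair determines soft thresholding. -/
lemma shrink_add_eq {r b : ℝ} (hr : |r| ≤ 1) (hrb : r * b = |b|) : shrink (r + b) = b := by
  have := abs_le.1 hr
  rcases lt_trichotomy b 0 with hb | hb | hb
  · rw [abs_of_neg hb] at hrb
    have : r = -1 := by
      have : (r + 1) * b = 0 := by linarith
      rcases mul_eq_zero.1 this with h | h <;> linarith
    rw [shrink_of_le_neg_one (by linarith)]
    linarith
  · rw [hb, add_zero, shrink_of_abs_le hr]
  · rw [abs_of_pos hb] at hrb
    have : r = 1 := by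
      have : (r - 1) * b = 0 := by linarith
      rcases mul_eq_zero.1 this with h | h <;> linarith
    rw [shrink_of_one_le (by linarith)]
    linarith

/-- Half the square of soft thresholding is a primitive of soft thresholding. -/
lemma hasDerivAt_half_sq_shrink (x : ℝ) :
    HasDerivAt (fun y => shrink y ^ 2 / 2) (shrink x) x := by
  have key : ∀ x : ℝ, HasDerivAt (fun y : ℝ => max y 0 ^ 2) (2 * max x 0) x := by
    intro x
    rcases lt_trichotomy x 0 with hx | hx | hx
    · rw [max_eq_right hx.le, mul_zero]
      refine (hasDerivAt_const x (0 : ℝ)).congr_of_eventuallyEq ?_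
      filter_upwards [Iio_mem_nhds hx] with y hy
      rw [max_eq_right (le_of_lt hy)]
      simp
    · subst hx
      rw [hasDerivAt_iff_isLittleO]
      simp only [sub_zero, max_self, mul_zero, smul_zero, ne_eq, OfNat.ofNat_ne_zero,
        not_false_eq_true, zero_pow]
      have h1 : (fun y : ℝ => max y 0 ^ 2) =O[𝓝 0] fun y : ℝ => y ^ 2 := by
        refine Asymptotics.IsBigO.of_bound 1 (Eventually.of_forall fun y => ?_)
        rw [one_mul, Real.norm_eq_abs, Real.norm_eq_abs, abs_pow, abs_pow]
        refine pow_le_pow_left₀ (abs_nonneg _) ?_ 2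
        rcases le_total y 0 with h | h
        · rw [max_eq_right h, abs_zero]
          exact abs_nonneg y
        · rw [max_eq_left h]
      refine h1.trans_isLittleO ?_
      simpa using Asymptotics.isLittleO_pow_pow (𝕜 := ℝ) (show 1 < 2 by norm_num)
    · rw [max_eq_left hx.le]
      have h : HasDerivAt (fun y : ℝ => y ^ 2) (2 * x) x := by
        simpa using hasDerivAt_pow 2 x
      refine h.congr_of_eventuallyEq ?_
      filter_upwards [Ioi_mem_nhds hx] with y hy
      rw [max_eq_left (le_of_lt hy)]
  have h1 := (key (x - 1)).comp x ((hasDerivAt_id x).sub_const 1)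
  have h2 := (key (-x - 1)).comp x ((hasDerivAt_id x).neg.sub_const 1)
  have h3 := (h1.add h2).div_const 2
  convert! h3 using 1
  · funext y
    simp only [Pi.add_apply, Function.comp_apply, id, Pi.neg_apply]
    rcases shrink_cases y with ⟨hy, h⟩ | ⟨hy, h⟩ | ⟨hy, hy', h⟩ <;> rw [h]
    · rw [max_eq_left (by linarith), max_eq_right (by linarith)]; ring
    · rw [max_eq_right (by linarith), max_eq_left (by linarith)]; ring
    · rw [max_eq_right (by linarith), max_eq_right (by linarith)]; ring
  · rw [shrink]; ring

/-! ### One-sided derivatives of soft thresholding along a curve -/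

/-- At a zero of f the right derivative of f⁺ is (f')⁺: a nonzero slope fixes the sign of f just
after t, and for slope zero f⁺ is dominated by |f| = o(s - t). -/
lemma hasDerivWithinAt_posPart {f f' : ℝ → ℝ} {t : ℝ}
    (hf : HasDerivWithinAt f (f' t) (Ici t) t) :
    HasDerivWithinAt (fun s => max (f s) 0)
      (if 0 < f t ∨ (f t = 0 ∧ 0 < f' t) then f' t else 0) (Ici t) t := by
  have hc := hf.continuousWithinAt
  rcases lt_trichotomy (f t) 0 with h | h | h
  · rw [if_neg (by rintro (h1 | h1) <;> [linarith; linarith [h1.1]])]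
    refine (hasDerivWithinAt_const t (Ici t) (0 : ℝ)).congr_of_eventuallyEq ?_ ?_
    · filter_upwards [hc.eventually (Iio_mem_nhds h)] with s hs
      exact max_eq_right (le_of_lt hs)
    · exact max_eq_right h.le
  · rcases le_or_gt (f' t) 0 with h' | h'
    · rw [if_neg (by rintro (h1 | h1) <;> [linarith; linarith [h1.2]])]
      rcases h'.lt_or_eq with h'' | h''
      · rw [hasDerivWithinAt_iff_tendsto_slope, Ici_sdiff_left] at hf ⊢
        refine tendsto_const_nhds.congr' ?_
        filter_upwards [hf.eventually (Iio_mem_nhds h''), self_mem_nhdsWithin] with s hs hst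
        have hst' : 0 < s - t := sub_pos.2 hst
        rw [slope_def_field, h, sub_zero, div_neg_iff] at hs
        have : f s ≤ 0 := by rcases hs with hs | hs <;> linarith
        rw [slope_def_field, h, max_eq_right this]
        simp
      · rw [h''] at hf
        rw [hasDerivWithinAt_iff_isLittleO] at hf ⊢
        simp only [h, max_self, sub_zero, smul_zero] at hf ⊢
        refine (Asymptotics.IsBigO.of_bound 1 (Eventually.of_forall fun s => ?_)).trans_isLittleO hf
        rw [one_mul, Real.norm_eq_abs, Real.norm_eq_abs]
        rcases le_total (f s) 0 with h | h
        · rw [max_eq_right h]; simp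
        · rw [max_eq_left h]
    · rw [if_pos (Or.inr ⟨h, h'⟩)]
      refine hf.congr_of_eventuallyEq ?_ (by rw [h, max_self])
      rw [hasDerivWithinAt_iff_tendsto_slope, Ici_sdiff_left] at hf
      have h1 := hf.eventually (Ioi_mem_nhds h')
      rw [← Ioi_insert, EventuallyEq, nhdsWithin_insert, eventually_sup, eventually_pure]
      refine ⟨by rw [h, max_self], ?_⟩
      filter_upwards [h1, self_mem_nhdsWithin] with s hs hst
      have hst' : 0 < s - t := sub_pos.2 hst
      rw [slope_def_field, h, sub_zero, div_pos_iff] at hs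
      exact max_eq_left (by rcases hs with hs | hs <;> linarith)
  · rw [if_pos (Or.inl h)]
    refine hf.congr_of_eventuallyEq ?_ (max_eq_left h.le)
    filter_upwards [hc.eventually (Ioi_mem_nhds h)] with s hs
    exact max_eq_left (le_of_lt hs)

/-- Only a zero of f with zero slope is delicate. There the case distinction may switch infinitely
often, but the value is always 0 or f', and f' tends to 0. This supplies the right continuity of ρ'
demanded of a path. -/
lemma continuousWithinAt_posPart_deriv {f f' : ℝ → ℝ} {t : ℝ}
    (hf : HasDerivWithinAt f (f' t) (Ici t) t) (hf' : ContinuousWithinAt f' (Ici t) t) :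
    ContinuousWithinAt (fun s => if 0 < f s ∨ (f s = 0 ∧ 0 < f' s) then f' s else 0)
      (Ici t) t := by
  have hc := hf.continuousWithinAt
  rcases lt_trichotomy (f t) 0 with h | h | h
  · have h0 : ∀ s, f s < 0 → (if 0 < f s ∨ (f s = 0 ∧ 0 < f' s) then f' s else 0) = 0 :=
      fun s hs => if_neg (by rintro (h1 | h1) <;> [linarith; linarith [h1.1]])
    refine (continuousWithinAt_const (b := (0 : ℝ))).congr_of_eventuallyEq ?_ (h0 t h)
    filter_upwards [hc.eventually (Iio_mem_nhds h)] with s hs using h0 s hs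
  · rcases lt_trichotomy (f' t) 0 with h' | h' | h'
    · have h0 : ∀ s, f s ≤ 0 → f' s < 0 →
          (if 0 < f s ∨ (f s = 0 ∧ 0 < f' s) then f' s else 0) = 0 :=
        fun s hs hs' => if_neg (by rintro (h1 | h1) <;> [linarith; linarith [h1.2]])
      refine (continuousWithinAt_const (b := (0 : ℝ))).congr_of_eventuallyEq ?_ (h0 t h.le h')
      rw [hasDerivWithinAt_iff_tendsto_slope, Ici_sdiff_left] at hf
      have h1 := hf.eventually (Iio_mem_nhds h')
      have h2 := (hf'.mono Ioi_subset_Ici_self).eventually (Iio_mem_nhds h')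
      rw [← Ioi_insert, EventuallyEq, nhdsWithin_insert, eventually_sup, eventually_pure]
      refine ⟨h0 t h.le h', ?_⟩
      filter_upwards [h1, h2, self_mem_nhdsWithin] with s hs hs' hst
      have hst' : 0 < s - t := sub_pos.2 hst
      rw [slope_def_field, h, sub_zero, div_neg_iff] at hs
      exact h0 s (by rcases hs with hs | hs <;> linarith) hs'
    · have h0 : (if 0 < f t ∨ (f t = 0 ∧ 0 < f' t) then f' t else 0) = 0 := by
        split_ifs <;> [exact h'; rfl]
      rw [ContinuousWithinAt, h0]
      rw [ContinuousWithinAt, h'] at hf'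
      refine squeeze_zero_norm (fun s => ?_) (by simpa using hf'.norm)
      split_ifs <;> simp
    · refine hf'.congr_of_eventuallyEq ?_ (if_pos (Or.inr ⟨h, h'⟩))
      rw [hasDerivWithinAt_iff_tendsto_slope, Ici_sdiff_left] at hf
      have h1 := hf.eventually (Ioi_mem_nhds h')
      rw [← Ioi_insert, EventuallyEq, nhdsWithin_insert, eventually_sup, eventually_pure]
      refine ⟨if_pos (Or.inr ⟨h, h'⟩), ?_⟩
      filter_upwards [h1, self_mem_nhdsWithin] with s hs hst
      have hst' : 0 < s - t := sub_pos.2 hst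
      rw [slope_def_field, h, sub_zero, div_pos_iff] at hs
      exact if_pos (Or.inl (by rcases hs with hs | hs <;> linarith))
  · refine hf'.congr_of_eventuallyEq ?_ (if_pos (Or.inl h))
    filter_upwards [hc.eventually (Ioi_mem_nhds h)] with s hs using if_pos (Or.inl hs)

/-- The right derivative of soft thresholding along a curve `f` with right derivative `f'`. -/
noncomputable def shrinkDeriv (f f' : ℝ → ℝ) (t : ℝ) : ℝ :=
  (if 0 < f t - 1 ∨ (f t - 1 = 0 ∧ 0 < f' t) then f' t else 0)
    - (if 0 < -f t - 1 ∨ (-f t - 1 = 0 ∧ 0 < -f' t) then -f' t else 0)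

lemma hasDerivWithinAt_shrink {f f' : ℝ → ℝ} {t : ℝ}
    (hf : HasDerivWithinAt f (f' t) (Ici t) t) :
    HasDerivWithinAt (fun s => shrink (f s)) (shrinkDeriv f f' t) (Ici t) t :=
  (hasDerivWithinAt_posPart (f := fun s => f s - 1) (f' := f') (hf.sub_const 1)).sub
    (hasDerivWithinAt_posPart (f := fun s => -f s - 1) (f' := fun s => -f' s)
      (hf.neg.sub_const 1))

lemma continuousWithinAt_shrinkDeriv {f f' : ℝ → ℝ} {t : ℝ}
    (hf : HasDerivWithinAt f (f' t) (Ici t) t) (hf' : ContinuousWithinAt f' (Ici t) t) :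
    ContinuousWithinAt (shrinkDeriv f f') (Ici t) t :=
  (continuousWithinAt_posPart_deriv (f := fun s => f s - 1) (f' := f') (hf.sub_const 1) hf').sub
    (continuousWithinAt_posPart_deriv (f := fun s => -f s - 1) (f' := fun s => -f' s)
      (hf.neg.sub_const 1) hf'.neg)

/-- The derivative of the thresholded curve is f' or 0, as thresholding is nondecreasing. This sign
is what makes the energy decrease. -/
lemma shrinkDeriv_mul_nonneg (f f' : ℝ → ℝ) (t : ℝ) : 0 ≤ f' t * shrinkDeriv f f' t := by
  unfold shrinkDeriv
  split_ifs <;> nlinarith [sq_nonneg (f' t)]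

/-! ### The smooth flow behind a path -/

/-- The primal variable `κ • shrink z`. -/
noncomputable def primal {ι : Type*} (κ : ℝ) (z : ι → ℝ) : ι → ℝ := fun i => κ * shrink (z i)

/-- `z` solves `z' = b - A (κ shrink z)`, `z 0 = 0`, on `[0, T]`. -/
structure IsFlowOn {ι : Type*} [Fintype ι] (A : Matrix ι ι ℝ) (b : ι → ℝ) (κ T : ℝ)
    (z : ℝ → ι → ℝ) : Prop where
  zero : z 0 = 0
  cont : ContinuousOn z (Icc 0 T)
  deriv : ∀ t ∈ Ico 0 T, HasDerivWithinAt z (b - A *ᵥ primal κ (z t)) (Ici t) t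

@[simp] lemma primal_zero {ι : Type*} (κ : ℝ) : primal κ (0 : ι → ℝ) = 0 := by
  funext i
  simp [primal]

lemma lipschitzWith_primal {ι : Type*} [Fintype ι] (κ : ℝ) :
    LipschitzWith ‖κ‖₊ (primal κ : (ι → ℝ) → ι → ℝ) := by
  refine LipschitzWith.of_dist_le_mul fun x y => ?_
  rw [dist_pi_le_iff (by positivity)]
  intro i
  rw [Real.dist_eq, primal, primal, ← mul_sub, abs_mul, coe_nnnorm, Real.norm_eq_abs]
  refine mul_le_mul_of_nonneg_left ?_ (abs_nonneg κ)
  exact (abs_shrink_sub_shrink_le _ _).trans (dist_le_pi_dist x y i)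

lemma exists_lipschitzWith_field {ι : Type*} [Fintype ι] (A : Matrix ι ι ℝ) (b : ι → ℝ) (κ : ℝ) :
    ∃ K : ℝ≥0, LipschitzWith K fun z : ι → ℝ => b - A *ᵥ primal κ z := by
  have h1 := (LinearMap.toContinuousLinearMap (Matrix.mulVecLin A)).lipschitz
  have h2 := (LipschitzWith.const b).sub (h1.comp (lipschitzWith_primal (ι := ι) κ))
  exact ⟨_, h2⟩

lemma IsFlowOn.eqOn {ι : Type*} [Fintype ι] {A : Matrix ι ι ℝ} {b : ι → ℝ} {κ T : ℝ}
    {z₁ z₂ : ℝ → ι → ℝ} (h₁ : IsFlowOn A b κ T z₁) (h₂ : IsFlowOn A b κ T z₂) :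
    EqOn z₁ z₂ (Icc 0 T) := by
  obtain ⟨K, hK⟩ := exists_lipschitzWith_field A b κ
  exact ODE_solution_unique_of_mem_Icc_right (K := K)
    (v := fun _ z => b - A *ᵥ primal κ z) (s := fun _ => univ)
    (fun _ _ => hK.lipschitzOnWith) h₁.cont h₁.deriv (fun _ _ => mem_univ _)
    h₂.cont h₂.deriv (fun _ _ => mem_univ _) (by rw [h₁.zero, h₂.zero])

lemma exists_flow {ι : Type*} [Fintype ι] (A : Matrix ι ι ℝ) (b : ι → ℝ) (κ : ℝ) :
    ∃ z : ℝ → ι → ℝ, z 0 = 0 ∧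
      ∀ t, 0 ≤ t → HasDerivWithinAt z (b - A *ᵥ primal κ (z t)) (Ici 0) t := by
  obtain ⟨K, hK⟩ := exists_lipschitzWith_field A b κ
  exact exists_global_solution hK

lemma isFlowOn_of_hasDerivWithinAt {ι : Type*} [Fintype ι] {A : Matrix ι ι ℝ} {b : ι → ℝ}
    {κ : ℝ} {z : ℝ → ι → ℝ} (h0 : z 0 = 0)
    (h : ∀ t, 0 ≤ t → HasDerivWithinAt z (b - A *ᵥ primal κ (z t)) (Ici 0) t) (T : ℝ) :
    IsFlowOn A b κ T z where
  zero := h0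
  cont := fun t ht => (h t ht.1).continuousWithinAt.mono Icc_subset_Ici_self
  deriv := fun t ht => (h t ht.1).mono (Ici_subset_Ici.2 ht.1)

/-! ### The subdifferential of the `ℓ₁` norm -/

lemma mem_subdifferential_l1norm_iff {p : ℕ} {g x : Fin p → ℝ} :
    g ∈ subdifferential l1norm x ↔ ∀ i, |g i| ≤ 1 ∧ g i * x i = |x i| := by
  constructor
  · intro h i
    -- Moving coordinate i alone isolates a scalar inequality; s = ±1 bounds g i, and s = -x i gives
    -- the equality.
    have key : ∀ s : ℝ, |x i| + g i * s ≤ |x i + s| := by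
      intro s
      have h1 := h (Function.update x i (x i + s))
      have h2 : g ⬝ᵥ (Function.update x i (x i + s) - x) = g i * s := by
        rw [dotProduct, Finset.sum_eq_single i]
        · simp
        · intro j _ hj
          simp [Function.update_of_ne hj]
        · simp
      have h3 : l1norm (Function.update x i (x i + s)) - l1norm x = |x i + s| - |x i| := by
        rw [l1norm, l1norm, ← Finset.sum_sub_distrib, Finset.sum_eq_single i]
        · simp
        · intro j _ hj
          simp [Function.update_of_ne hj]
        · simp
      rw [h2] at h1
      linarith
    have h1 : |g i| ≤ 1 := by
      rw [abs_le]
      have ha := key 1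
      have hb := key (-1)
      have hc := abs_add_le (x i) 1
      have hd := abs_add_le (x i) (-1)
      rw [abs_neg, abs_one] at hd
      rw [abs_one] at hc
      constructor <;> linarith
    refine ⟨h1, le_antisymm ?_ ?_⟩
    · refine (le_abs_self _).trans ?_
      rw [abs_mul]
      exact mul_le_of_le_one_left (abs_nonneg _) h1
    · have := key (-x i)
      rw [add_neg_cancel, abs_zero] at this
      linarith
  · intro h z
    have h1 : l1norm x + g ⬝ᵥ (z - x) = ∑ i, g i * z i := by
      rw [l1norm, dotProduct, ← Finset.sum_add_distrib]
      refine Finset.sum_congr rfl fun i _ => ?_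
      rw [← (h i).2, Pi.sub_apply]
      ring
    rw [h1, l1norm]
    refine Finset.sum_le_sum fun i _ => (le_abs_self _).trans ?_
    rw [abs_mul]
    exact mul_le_of_le_one_left (abs_nonneg _) (h i).1

/-! ### Paths and flows -/

lemma adj_mulVec_residual {n p : ℕ} (X : Matrix (Fin n) (Fin p) ℝ) (y : Fin n → ℝ)
    (β : Fin p → ℝ) : adj X *ᵥ (y - X *ᵥ β) = adj X *ᵥ y - (adj X * X) *ᵥ β := by
  rw [Matrix.mulVec_sub, Matrix.mulVec_mulVec]

lemma exists_isPath {n p : ℕ} (X : Matrix (Fin n) (Fin p) ℝ) (y : Fin n → ℝ) {κ : ℝ}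
    (hκ : 0 < κ) : ∃ ρ β : ℝ → Fin p → ℝ, IsPath X y κ ρ β := by
  obtain ⟨z, hz0, hz⟩ := exists_flow (adj X * X) (adj X *ᵥ y) κ
  have hzc : ContinuousOn z (Ici 0) := fun t ht => (hz t ht).continuousWithinAt
  have hzc' : ∀ i, ContinuousOn (fun t => z t i) (Ici 0) := fun i => continuousOn_pi.1 hzc i
  set z' : ℝ → Fin p → ℝ := fun t => adj X *ᵥ y - (adj X * X) *ᵥ primal κ (z t) with hz'
  have hp : Continuous fun v : Fin p → ℝ => adj X *ᵥ y - (adj X * X) *ᵥ primal κ v :=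
    (exists_lipschitzWith_field (adj X * X) (adj X *ᵥ y) κ).choose_spec.continuous
  have hz'c : ContinuousOn z' (Ici 0) := hp.comp_continuousOn hzc
  have hzi : ∀ i t, 0 ≤ t → HasDerivWithinAt (fun s => z s i) (z' t i) (Ici t) t :=
    fun i t ht => hasDerivWithinAt_pi.1 ((hz t ht).mono (Ici_subset_Ici.2 ht)) i
  have hz'i : ∀ i t, 0 ≤ t → ContinuousWithinAt (fun s => z' s i) (Ici t) t :=
    fun i t ht => (continuousOn_pi.1 hz'c i t ht).mono (Ici_subset_Ici.2 ht)
  refine ⟨fun t i => z t i - shrink (z t i), fun t => primal κ (z t), ?_⟩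
  refine ⟨?_, ?_, ?_, ?_, ?_, ?_⟩
  · funext i
    simp [hz0]
  · simp [hz0]
  · exact continuousOn_pi.2 fun i => (hzc' i).sub (continuous_shrink.comp_continuousOn (hzc' i))
  · exact (lipschitzWith_primal κ).continuous.comp_continuousOn hzc
  · intro t _
    refine mem_subdifferential_l1norm_iff.2 fun i => ⟨abs_sub_shrink_le _, ?_⟩
    rw [primal, abs_mul, abs_of_pos hκ, ← sub_shrink_mul_shrink]
    ring
  · refine ⟨fun t i => z' t i - shrinkDeriv (fun s => z s i) (fun s => z' s i) t,
      fun t i => κ * shrinkDeriv (fun s => z s i) (fun s => z' s i) t, fun t ht => ⟨?_, ?_, ?_, ?_⟩⟩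
    · exact hasDerivWithinAt_pi.2 fun i =>
        (hzi i t ht).sub (hasDerivWithinAt_shrink (f' := fun s => z' s i) (hzi i t ht))
    · exact continuousWithinAt_pi.2 fun i =>
        (hz'i i t ht).sub (continuousWithinAt_shrinkDeriv (hzi i t ht) (hz'i i t ht))
    · exact hasDerivWithinAt_pi.2 fun i =>
        (hasDerivWithinAt_shrink (f' := fun s => z' s i) (hzi i t ht)).const_mul κ
    · rw [adj_mulVec_residual]
      funext i
      simp only [Pi.add_apply, Pi.smul_apply, smul_eq_mul]
      field_simp
      simp [hz']

/-- The pair (ρ, β) can be read off from ρ + β/κ, since a subgradient is compatible in sign with β.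
Uniqueness of paths thus reduces to uniqueness for a Lipschitz equation. -/
lemma IsPath.primal_eq {n p : ℕ} {X : Matrix (Fin n) (Fin p) ℝ} {y : Fin n → ℝ} {κ : ℝ}
    {ρ β : ℝ → Fin p → ℝ} (h : IsPath X y κ ρ β) (hκ : 0 < κ) {t : ℝ} (ht : 0 ≤ t) :
    primal κ (ρ t + (1 / κ) • β t) = β t := by
  funext i
  obtain ⟨h1, h2⟩ := mem_subdifferential_l1norm_iff.1 (h.subgradient t ht) i
  have h3 : shrink (ρ t i + 1 / κ * β t i) = 1 / κ * β t i := by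
    refine shrink_add_eq h1 ?_
    rw [abs_mul, abs_of_pos (by positivity : 0 < 1 / κ), ← h2]
    ring
  rw [primal, Pi.add_apply, Pi.smul_apply, smul_eq_mul, h3]
  field_simp

lemma IsPath.isFlowOn {n p : ℕ} {X : Matrix (Fin n) (Fin p) ℝ} {y : Fin n → ℝ} {κ : ℝ}
    {ρ β : ℝ → Fin p → ℝ} (h : IsPath X y κ ρ β) (hκ : 0 < κ) (T : ℝ) :
    IsFlowOn (adj X * X) (adj X *ᵥ y) κ T fun t => ρ t + (1 / κ) • β t where
  zero := by simp [h.rho_zero, h.beta_zero]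
  cont := (h.rho_continuous.add (h.beta_continuous.const_smul (1 / κ))).mono Icc_subset_Ici_self
  deriv := fun t ht => by
    obtain ⟨ρ', β', h'⟩ := h.evolution
    obtain ⟨h1, _, h2, h3⟩ := h' t ht.1
    rw [h.primal_eq hκ ht.1, ← adj_mulVec_residual, ← h3]
    exact h1.add (h2.const_smul (1 / κ))

/-! ### Decay of a potential dominated by an increasing function of its dissipation -/

/-- Used with a = 0 for monotonicity of the potential and with a > 0 for the final stretch of
constant dissipation. -/
lemma le_of_hasDerivWithinAt_le_neg {Φ Φ' x : ℝ → ℝ} {γ T t₀ t₁ a : ℝ} (hγ : 0 ≤ γ)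
    (hc : ContinuousOn Φ (Icc 0 T))
    (hd : ∀ t ∈ Ico 0 T, HasDerivWithinAt Φ (Φ' t) (Ici t) t)
    (hle : ∀ t ∈ Ico 0 T, Φ' t ≤ -(γ * x t)) (ha : ∀ t ∈ Ico 0 T, a ≤ x t)
    (ht₀ : 0 ≤ t₀) (ht : t₀ ≤ t₁) (ht₁ : t₁ ≤ T) :
    Φ t₁ ≤ Φ t₀ - γ * a * (t₁ - t₀) := by
  have hB : ∀ t, HasDerivAt (fun t => Φ t₀ - γ * a * (t - t₀)) (-(γ * a)) t := fun t => by
    simpa using (((hasDerivAt_id t).sub_const t₀).const_mul (γ * a)).const_sub (Φ t₀)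
  refine image_le_of_deriv_right_le_deriv_boundary (a := t₀) (b := t₁)
    (B := fun t => Φ t₀ - γ * a * (t - t₀)) (B' := fun _ => -(γ * a))
    (hc.mono (Icc_subset_Icc ht₀ ht₁)) (fun t ht => hd t ⟨ht₀.trans ht.1, ht.2.trans_le ht₁⟩)
    (by simp) (fun t _ => (hB t).continuousAt.continuousWithinAt)
    (fun t _ => (hB t).hasDerivWithinAt) (fun t ht => ?_) ⟨ht, le_rfl⟩
  have hmem : t ∈ Ico 0 T := ⟨ht₀.trans ht.1, ht.2.trans_le ht₁⟩
  exact (hle t hmem).trans (neg_le_neg (mul_le_mul_of_nonneg_left (ha t hmem) hγ))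

/-- If `Φ' ≤ -γ x` and `F v ≤ Φ` forces `v ≤ x`, then `Φ` drops from `F v₀` to `F v₁` within time
`(1 / γ') ∫ F'(v) / v dv` for every `γ' < γ`. -/
lemma le_of_dissipation {Φ Φ' x F F' K : ℝ → ℝ} {γ γ' T v₀ v₁ t₀ : ℝ} (hγ' : 0 < γ')
    (hγ : γ' < γ) (hc : ContinuousOn Φ (Icc 0 T))
    (hd : ∀ t ∈ Ico 0 T, HasDerivWithinAt Φ (Φ' t) (Ici t) t)
    (hle : ∀ t ∈ Ico 0 T, Φ' t ≤ -(γ * x t)) (hv₁ : 0 < v₁) (hv : v₁ ≤ v₀)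
    (hF : ∀ v ∈ Icc v₁ v₀, HasDerivAt F (F' v) v) (hF' : ∀ v ∈ Icc v₁ v₀, 0 < F' v)
    (hK : ∀ v ∈ Icc v₁ v₀, HasDerivAt K (F' v / v) v)
    (hx : ∀ t ∈ Ico 0 T, ∀ v ∈ Icc v₁ v₀, F v ≤ Φ t → v ≤ x t) (ht₀ : 0 ≤ t₀)
    (hΦ : Φ t₀ ≤ F v₀) (hT : t₀ + (K v₀ - K v₁) / γ' ≤ T) :
    Φ (t₀ + (K v₀ - K v₁) / γ') ≤ F v₁ := by
  set R := v₀ - v₁ with hR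
  have hR0 : 0 ≤ R := sub_nonneg.2 hv
  have hmem : ∀ r ∈ Icc 0 R, v₀ - r ∈ Icc v₁ v₀ := fun r hr =>
    ⟨by linarith [hr.2], by linarith [hr.1]⟩
  -- Time is reparametrized by the level v = v₀ - r: τ r is the moment by which Φ should have fallen
  -- to F v.
  set τ : ℝ → ℝ := fun r => t₀ + (K v₀ - K (v₀ - r)) / γ' with hτ
  have hsub : ∀ r : ℝ, HasDerivAt (fun r => v₀ - r) (-1) r := fun r => by
    simpa using (hasDerivAt_id r).const_sub v₀
  have hτd : ∀ r ∈ Icc 0 R, HasDerivAt τ (F' (v₀ - r) / (v₀ - r) / γ') r := by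
    intro r hr
    have h1 := (hK _ (hmem r hr)).comp r (hsub r)
    have h2 := ((h1.const_sub (K v₀)).div_const γ').const_add t₀
    convert! h2 using 1
    ring
  have hvpos : ∀ r ∈ Icc 0 R, 0 < v₀ - r := fun r hr => hv₁.trans_le (hmem r hr).1
  have hτc : ContinuousOn τ (Icc 0 R) := fun r hr => (hτd r hr).continuousAt.continuousWithinAt
  have hmono : StrictMonoOn τ (Icc 0 R) := by
    refine strictMonoOn_of_deriv_pos (convex_Icc 0 R) hτc fun r hr => ?_
    have hr' := interior_subset hr
    rw [(hτd r hr').deriv]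
    exact div_pos (div_pos (hF' _ (hmem r hr')) (hvpos r hr')) hγ'
  have hτ0 : τ 0 = t₀ := by simp [hτ]
  have hτR : τ R = t₀ + (K v₀ - K v₁) / γ' := by simp [hτ, hR]
  have h0R : (0 : ℝ) ∈ Icc 0 R := ⟨le_rfl, hR0⟩
  have hRR : R ∈ Icc 0 R := ⟨hR0, le_rfl⟩
  have hτmem : ∀ r ∈ Icc 0 R, τ r ∈ Icc 0 T := fun r hr =>
    ⟨by have := hmono.monotoneOn h0R hr hr.1
        linarith, by
        have := hmono.monotoneOn hr hRR hr.2
        linarith⟩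
  have hτmem' : ∀ r ∈ Ico 0 R, τ r ∈ Ico 0 T := fun r hr =>
    ⟨(hτmem r ⟨hr.1, hr.2.le⟩).1, by
        have := hmono ⟨hr.1, hr.2.le⟩ hRR hr.2
        linarith⟩
  -- Derivatives need comparing only at contact, Φ(τ r) = F v, where v ≤ x is available. The
  -- comparison must be strict, which is why γ' < γ.
  have key := image_le_of_deriv_right_lt_deriv_boundary' (f := fun r => Φ (τ r))
    (f' := fun r => Φ' (τ r) * (F' (v₀ - r) / (v₀ - r) / γ')) (a := 0) (b := R)
    (B := fun r => F (v₀ - r)) (B' := fun r => F' (v₀ - r) * -1)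
    (hc.comp hτc hτmem) ?_ (by simpa [hτ0] using hΦ) ?_ ?_ ?_ hRR
  · have key' : Φ (τ R) ≤ F (v₀ - R) := key
    rwa [hτR, hR, sub_sub_cancel] at key'
  · intro r hr
    have h1 : HasDerivWithinAt τ (F' (v₀ - r) / (v₀ - r) / γ') (Ico r R) r :=
      (hτd r ⟨hr.1, hr.2.le⟩).hasDerivWithinAt
    have h2 : MapsTo τ (Ico r R) (Ici (τ r)) := fun s hs =>
      hmono.monotoneOn ⟨hr.1, hr.2.le⟩ ⟨hr.1.trans hs.1, hs.2.le⟩ hs.1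
    exact ((hd _ (hτmem' r hr)).comp r h1 h2).mono_of_mem_nhdsWithin (Ico_mem_nhdsGE hr.2)
  · exact fun r hr => ((hF _ (hmem r hr)).comp r (hsub r)).continuousAt.continuousWithinAt
  · exact fun r hr => ((hF _ (hmem r ⟨hr.1, hr.2.le⟩)).comp r (hsub r)).hasDerivWithinAt
  · intro r hr hEq
    have hr' : r ∈ Icc 0 R := ⟨hr.1, hr.2.le⟩
    have hv' := hvpos r hr'
    have hF'' := hF' _ (hmem r hr')
    have hxv := hx _ (hτmem' r hr) _ (hmem r hr') hEq.ge
    have h1 : Φ' (τ r) < -(γ' * (v₀ - r)) := by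
      refine (hle _ (hτmem' r hr)).trans_lt (neg_lt_neg ?_)
      calc γ' * (v₀ - r) < γ * (v₀ - r) := mul_lt_mul_of_pos_right hγ hv'
        _ ≤ γ * x (τ r) := mul_le_mul_of_nonneg_left hxv (hγ'.trans hγ).le
    calc Φ' (τ r) * (F' (v₀ - r) / (v₀ - r) / γ')
        < -(γ' * (v₀ - r)) * (F' (v₀ - r) / (v₀ - r) / γ') :=
          mul_lt_mul_of_pos_right h1 (by positivity)
      _ = F' (v₀ - r) * -1 := by field_simp

/-! ### The potential along the restricted flow -/

section Calculus

variable {ι : Type*} [Fintype ι]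

lemma hasDerivWithinAt_dotProduct {u v : ℝ → ι → ℝ} {u' v' : ι → ℝ} {s : Set ℝ} {t : ℝ}
    (hu : HasDerivWithinAt u u' s t) (hv : HasDerivWithinAt v v' s t) :
    HasDerivWithinAt (fun r => u r ⬝ᵥ v r) (u' ⬝ᵥ v t + u t ⬝ᵥ v') s t := by
  rw [hasDerivWithinAt_pi] at hu hv
  simp only [dotProduct, ← Finset.sum_add_distrib]
  exact HasDerivWithinAt.fun_sum fun i _ => (hu i).mul (hv i)

lemma hasDerivWithinAt_mulVec {κ : Type*} [Fintype κ] (H : Matrix κ ι ℝ) {u : ℝ → ι → ℝ}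
    {u' : ι → ℝ} {s : Set ℝ} {t : ℝ} (hu : HasDerivWithinAt u u' s t) :
    HasDerivWithinAt (fun r => H *ᵥ u r) (H *ᵥ u') s t :=
  (LinearMap.toContinuousLinearMap (Matrix.mulVecLin H)).hasFDerivAt.comp_hasDerivWithinAt t hu

end Calculus

section Restricted

variable {ι : Type*} [Fintype ι] {H : Matrix ι ι ℝ} {w : ι → ℝ} {γ κ T : ℝ} {z : ℝ → ι → ℝ}

lemma continuousOn_primal (hz : ContinuousOn z (Icc 0 T)) :
    ContinuousOn (fun t => primal κ (z t)) (Icc 0 T) :=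
  (lipschitzWith_primal κ).continuous.comp_continuousOn hz

/-- The quadratic energy of the error does not increase. -/
lemma IsFlowOn.energy_le (h : IsFlowOn H (H *ᵥ w) κ T z) (hH : H.IsSymm) (hκ : 0 ≤ κ) {t : ℝ}
    (ht : t ∈ Icc 0 T) :
    (primal κ (z t) - w) ⬝ᵥ H *ᵥ (primal κ (z t) - w) ≤ w ⬝ᵥ H *ᵥ w := by
  set z' : ℝ → ι → ℝ := fun t => H *ᵥ w - H *ᵥ primal κ (z t) with hz'
  set β' : ℝ → ι → ℝ := fun t i => κ * shrinkDeriv (fun s => z s i) (fun s => z' s i) t with hβ'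
  have hβ : ∀ t ∈ Ico 0 T, HasDerivWithinAt (fun s => primal κ (z s) - w) (β' t) (Ici t) t := by
    intro t ht
    refine HasDerivWithinAt.sub_const w (hasDerivWithinAt_pi.2 fun i => ?_)
    exact (hasDerivWithinAt_shrink (f' := fun s => z' s i)
      (hasDerivWithinAt_pi.1 (h.deriv t ht) i)).const_mul κ
  have hE := fun t ht => hasDerivWithinAt_dotProduct (hβ t ht) (hasDerivWithinAt_mulVec H (hβ t ht))
  have hc : ContinuousOn (fun s => primal κ (z s) - w) (Icc 0 T) :=
    (continuousOn_primal h.cont).sub continuousOn_const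
  have hcE : ContinuousOn (fun s => (primal κ (z s) - w) ⬝ᵥ H *ᵥ (primal κ (z s) - w))
      (Icc 0 T) := by
    have : Continuous fun v : ι → ℝ => v ⬝ᵥ H *ᵥ v := by
      simp only [dotProduct, Matrix.mulVec]
      fun_prop
    exact this.comp_continuousOn hc
  refine image_le_of_deriv_right_le_deriv_boundary (B := fun _ => w ⬝ᵥ H *ᵥ w) (B' := fun _ => 0)
    hcE hE ?_ continuousOn_const (fun s _ => hasDerivWithinAt_const s _ _) (fun s hs => ?_) ht
  · simp [h.zero, Matrix.mulVec_neg]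
  · have h1 : (primal κ (z s) - w) ⬝ᵥ H *ᵥ β' s = β' s ⬝ᵥ H *ᵥ (primal κ (z s) - w) := by
      rw [Matrix.dotProduct_mulVec, ← Matrix.mulVec_transpose, hH.eq, dotProduct_comm]
    have h2 : H *ᵥ (primal κ (z s) - w) = -z' s := by
      rw [hz', Matrix.mulVec_sub]
      simp
    -- The derivative of the energy is -2 β'·z', so it suffices that thresholding preserves the
    -- direction of motion in each coordinate.
    have h3 : 0 ≤ β' s ⬝ᵥ z' s := by
      refine Finset.sum_nonneg fun i _ => ?_
      have := mul_nonneg hκ (shrinkDeriv_mul_nonneg (fun s => z s i) (fun s => z' s i) s)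
      calc (0 : ℝ) ≤ _ := this
        _ = β' s i * z' s i := by rw [hβ']; ring
    rw [h1, h2, dotProduct_neg]
    linarith

/-- The squared distance of the primal variable to the target. -/
noncomputable def sqErr (κ : ℝ) (w z : ι → ℝ) : ℝ := ∑ i, (primal κ z i - w i) ^ 2

/-- The Bregman divergence to the target plus the scaled squared distance. -/
noncomputable def potential (κ : ℝ) (w z : ι → ℝ) : ℝ :=
  ∑ i, (|w i| + w i ^ 2 / (2 * κ) + κ * (shrink (z i) ^ 2 / 2) - z i * w i)

lemma sqErr_eq_dotProduct (κ : ℝ) (w z : ι → ℝ) :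
    sqErr κ w z = (primal κ z - w) ⬝ᵥ (primal κ z - w) := by
  simp [sqErr, dotProduct, sq]

lemma potential_eq (hκ : 0 < κ) (w z : ι → ℝ) :
    potential κ w z = ∑ i, (|w i| - (z i - shrink (z i)) * w i) + sqErr κ w z / (2 * κ) := by
  rw [potential, sqErr, Finset.sum_div, ← Finset.sum_add_distrib]
  refine Finset.sum_congr rfl fun i _ => ?_
  rw [primal]
  field_simp
  ring

lemma gap_nonneg (w z : ℝ) : 0 ≤ |w| - (z - shrink z) * w := by
  have h1 : (z - shrink z) * w ≤ |w| := (le_abs_self _).trans (by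
    rw [abs_mul]
    exact mul_le_of_le_one_left (abs_nonneg _) (abs_sub_shrink_le z))
  linarith

/-- If β_i and w_i have strictly the same sign, the subgradient is sign(w_i) and the Bregman gap
vanishes. Otherwise β_i lies on the wrong side of 0, so the error is at least |w_i|, while the gap
never exceeds 2|w_i|. -/
lemma gap_eq_zero_or (hκ : 0 < κ) (w z : ℝ) :
    |w| - (z - shrink z) * w = 0 ∨
      (|w| ≤ |κ * shrink z - w| ∧ |w| - (z - shrink z) * w ≤ 2 * |w|) := by
  rcases lt_or_ge 0 (shrink z * w) with h | h
  · left
    rcases shrink_cases z with ⟨hz, hs⟩ | ⟨hz, hs⟩ | ⟨_, _, hs⟩ <;> rw [hs] at h ⊢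
    · have : 0 < w := by
        by_contra hw
        nlinarith
      rw [abs_of_pos this]
      ring
    · have : w < 0 := by
        by_contra hw
        nlinarith
      rw [abs_of_neg this]
      ring
    · simp at h
  · right
    constructor
    · rw [← sq_le_sq]
      nlinarith [sq_nonneg (κ * shrink z), mul_nonneg hκ.le (neg_nonneg.2 h)]
    · have h1 : -((z - shrink z) * w) ≤ |w| := (neg_le_abs _).trans (by
        rw [abs_mul]
        exact mul_le_of_le_one_left (abs_nonneg _) (abs_sub_shrink_le z))
      linarith

lemma sqErr_nonneg (κ : ℝ) (w z : ι → ℝ) : 0 ≤ sqErr κ w z :=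
  Finset.sum_nonneg fun _ _ => sq_nonneg _

lemma sqErr_div_le_potential (hκ : 0 < κ) (w z : ι → ℝ) :
    sqErr κ w z / (2 * κ) ≤ potential κ w z := by
  rw [potential_eq hκ]
  have : 0 ≤ ∑ i, (|w i| - (z i - shrink (z i)) * w i) :=
    Finset.sum_nonneg fun i _ => gap_nonneg _ _
  linarith

/-- Each gap is at most twice the error in its coordinate; Cauchy-Schwarz then bounds their sum. -/
lemma potential_le_sqrt (hκ : 0 < κ) (w z : ι → ℝ) :
    potential κ w z ≤
      sqErr κ w z / (2 * κ) + 2 * √(Fintype.card ι : ℝ) * √(sqErr κ w z) := by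
  rw [potential_eq hκ, add_comm]
  gcongr
  have h1 : ∀ i, |w i| - (z i - shrink (z i)) * w i ≤ 2 * |primal κ z i - w i| := by
    intro i
    rcases gap_eq_zero_or hκ (w i) (z i) with h | ⟨h, h'⟩
    · rw [h]; positivity
    · rw [primal]; linarith
  have h2 : ∑ i, |primal κ z i - w i| ≤ √(Fintype.card ι : ℝ) * √(sqErr κ w z) := by
    rw [← Real.sqrt_mul (Nat.cast_nonneg _)]
    refine Real.le_sqrt_of_sq_le ?_
    refine (sq_sum_le_card_mul_sum_sq (s := Finset.univ)
      (f := fun i => |primal κ z i - w i|)).trans_eq ?_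
    simp [sqErr]
  calc ∑ i, (|w i| - (z i - shrink (z i)) * w i) ≤ ∑ i, 2 * |primal κ z i - w i| :=
        Finset.sum_le_sum fun i _ => h1 i
    _ = 2 * ∑ i, |primal κ z i - w i| := by rw [Finset.mul_sum]
    _ ≤ _ := by linarith

/-- A nonzero gap requires an error of at least |w_i| ≥ m, and then 2|w_i| ≤ (2/m)|w_i|² is at most
2/m times the squared error. -/
lemma potential_le_linear (hκ : 0 < κ) {m : ℝ} (hm : 0 < m) {w : ι → ℝ} (hw : ∀ i, m ≤ |w i|)
    (z : ι → ℝ) :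
    potential κ w z ≤ sqErr κ w z * (1 / (2 * κ) + 2 / m) := by
  rw [potential_eq hκ, mul_add, add_comm, mul_one_div]
  gcongr
  rw [sqErr, Finset.sum_mul]
  refine Finset.sum_le_sum fun i _ => ?_
  rcases gap_eq_zero_or hκ (w i) (z i) with h | ⟨h, h'⟩
  · rw [h]; positivity
  · have h1 : w i ^ 2 ≤ (primal κ z i - w i) ^ 2 := sq_le_sq.2 h
    have h2 : m * |w i| ≤ w i ^ 2 := by
      rw [← sq_abs, sq]
      exact mul_le_mul_of_nonneg_right (hw i) (abs_nonneg _)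
    refine h'.trans ?_
    rw [mul_div_assoc', le_div_iff₀ hm]
    linarith

lemma sq_le_sqErr (κ : ℝ) (w z : ι → ℝ) (i : ι) : (primal κ z i - w i) ^ 2 ≤ sqErr κ w z :=
  Finset.single_le_sum (f := fun i => (primal κ z i - w i) ^ 2) (fun _ _ => sq_nonneg _)
    (Finset.mem_univ i)

/-- A single wrong sign already costs m² in squared error, so below that level every Bregman gap
vanishes. -/
lemma potential_eq_of_sqErr_lt (hκ : 0 < κ) {m : ℝ} (hm : 0 < m) {w : ι → ℝ}
    (hw : ∀ i, m ≤ |w i|) {z : ι → ℝ} (h : sqErr κ w z < m ^ 2) :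
    potential κ w z = sqErr κ w z / (2 * κ) := by
  rw [potential_eq hκ, add_eq_right]
  refine Finset.sum_eq_zero fun i _ => ?_
  refine (gap_eq_zero_or hκ (w i) (z i)).resolve_right fun h' => ?_
  have h1 : m ^ 2 ≤ (primal κ z i - w i) ^ 2 :=
    sq_le_sq.2 (by rw [abs_of_pos hm]; exact (hw i).trans h'.1)
  linarith [sq_le_sqErr κ w z i]

/-- Written in z alone, the potential has gradient κ·shrink(z) - w = β - w, and z' = -H(β - w). Thus
ρ and β need not be differentiated separately. -/
lemma IsFlowOn.hasDerivWithinAt_potential (h : IsFlowOn H (H *ᵥ w) κ T z) {t : ℝ}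
    (ht : t ∈ Ico 0 T) :
    HasDerivWithinAt (fun s => potential κ w (z s))
      (-((primal κ (z t) - w) ⬝ᵥ H *ᵥ (primal κ (z t) - w))) (Ici t) t := by
  have hz := hasDerivWithinAt_pi.1 (h.deriv t ht)
  have h1 : HasDerivWithinAt (fun s => potential κ w (z s))
      (∑ i, (κ * (shrink (z t i) * (H *ᵥ w - H *ᵥ primal κ (z t)) i)
        - (H *ᵥ w - H *ᵥ primal κ (z t)) i * w i)) (Ici t) t := by
    refine HasDerivWithinAt.fun_sum fun i _ => ?_
    refine HasDerivWithinAt.sub ?_ ((hz i).mul_const (w i))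
    refine HasDerivWithinAt.const_add _ (HasDerivWithinAt.const_mul κ ?_)
    exact (hasDerivAt_half_sq_shrink (z t i)).comp_hasDerivWithinAt t (hz i)
  convert! h1 using 1
  rw [← dotProduct_neg, Matrix.mulVec_sub, neg_sub]
  refine Finset.sum_congr rfl fun i _ => ?_
  simp only [Pi.sub_apply, primal]
  ring

lemma IsFlowOn.continuousOn_potential {A : Matrix ι ι ℝ} {b : ι → ℝ} (h : IsFlowOn A b κ T z) :
    ContinuousOn (fun s => potential κ w (z s)) (Icc 0 T) := by
  have : Continuous (potential κ w) := by
    unfold potential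
    refine continuous_finsetSum _ fun i _ => ?_
    have := continuous_shrink.comp (continuous_apply (A := fun _ : ι => ℝ) i)
    simp only [Function.comp_def] at this
    fun_prop
  exact this.comp_continuousOn h.cont

lemma IsFlowOn.deriv_potential_le (hH : ∀ v : ι → ℝ, γ * (v ⬝ᵥ v) ≤ v ⬝ᵥ H *ᵥ v) (t : ℝ) :
    -((primal κ (z t) - w) ⬝ᵥ H *ᵥ (primal κ (z t) - w)) ≤ -(γ * sqErr κ w (z t)) := by
  rw [sqErr_eq_dotProduct]
  exact neg_le_neg (hH _)

lemma sqErr_zero (κ : ℝ) (w : ι → ℝ) : sqErr κ w 0 = w ⬝ᵥ w := by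
  simp [sqErr_eq_dotProduct]

lemma IsFlowOn.potential_le_sqrt_phase (h : IsFlowOn H (H *ᵥ w) κ T z) (hκ : 0 < κ)
    (hH : ∀ v : ι → ℝ, γ * (v ⬝ᵥ v) ≤ v ⬝ᵥ H *ᵥ v) {γ' : ℝ} (hγ' : 0 < γ') (hγ : γ' < γ)
    {v₁ : ℝ} (hv₁ : 0 < v₁) (hv : v₁ ≤ w ⬝ᵥ w) {t₁ : ℝ}
    (ht₁ : t₁ = ((Real.log (w ⬝ᵥ w) - Real.log v₁) / (2 * κ)
      + 2 * √(Fintype.card ι : ℝ) * (1 / √v₁ - 1 / √(w ⬝ᵥ w))) / γ') (hT : t₁ ≤ T) :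
    potential κ w (z t₁) ≤ v₁ / (2 * κ) + 2 * √(Fintype.card ι : ℝ) * √v₁ := by
  set c := √(Fintype.card ι : ℝ) with hc
  have hc0 : 0 ≤ c := Real.sqrt_nonneg _
  set F : ℝ → ℝ := fun v => v / (2 * κ) + 2 * c * √v with hFdef
  set K : ℝ → ℝ := fun v => Real.log v / (2 * κ) - 2 * c * (√v)⁻¹ with hKdef
  have hmono : ∀ a b, 0 ≤ a → a < b → F a < F b := by
    intro a b _ hab
    have := Real.sqrt_le_sqrt hab.le
    have h1 : 2 * c * √a ≤ 2 * c * √b := by gcongr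
    have h2 : a / (2 * κ) < b / (2 * κ) := by gcongr
    exact add_lt_add_of_lt_of_le h2 h1
  have key := le_of_dissipation (Φ := fun s => potential κ w (z s))
    (x := fun s => sqErr κ w (z s)) (F := F)
    (F' := fun v => 1 / (2 * κ) + 2 * c * (1 / (2 * √v))) (K := K) (v₀ := w ⬝ᵥ w) (v₁ := v₁)
    (t₀ := 0) hγ' hγ h.continuousOn_potential (fun t ht => h.hasDerivWithinAt_potential ht)
    (fun t _ => IsFlowOn.deriv_potential_le hH t) hv₁ hv ?_ ?_ ?_ ?_ le_rfl ?_ ?_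
  · convert key using 3
    rw [ht₁]
    simp only [hKdef]
    ring
  · intro v hv'
    have hvpos : 0 < v := hv₁.trans_le hv'.1
    exact ((hasDerivAt_id v).div_const _).add
      ((Real.hasDerivAt_sqrt hvpos.ne').const_mul (2 * c))
  · intro v hv'
    have hvpos : 0 < v := hv₁.trans_le hv'.1
    have := Real.sqrt_pos.2 hvpos
    positivity
  · intro v hv'
    have hvpos : 0 < v := hv₁.trans_le hv'.1
    have hs := Real.sqrt_pos.2 hvpos
    have h1 := ((Real.hasDerivAt_log hvpos.ne').div_const (2 * κ)).sub
      (((Real.hasDerivAt_sqrt hvpos.ne').inv hs.ne').const_mul (2 * c))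
    convert! h1 using 1
    rw [Real.sq_sqrt hvpos.le]
    field_simp
    ring
  · intro t _ v hv' hle
    by_contra hlt
    have h1 := hmono _ _ (sqErr_nonneg κ w (z t)) (not_le.1 hlt)
    exact absurd (hle.trans (potential_le_sqrt hκ w (z t))) (not_le.2 h1)
  · have := potential_le_sqrt hκ w (z 0)
    rwa [h.zero, sqErr_zero, ← h.zero] at this
  · refine le_trans (le_of_eq ?_) hT
    rw [ht₁]
    simp only [hKdef]
    ring

/-- The restricted flow comes within distance `c` of its target before time `T`. -/
lemma IsFlowOn.exists_sqErr_le (h : IsFlowOn H (H *ᵥ w) κ T z) (hκ : 0 < κ)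
    (hH : ∀ v : ι → ℝ, γ * (v ⬝ᵥ v) ≤ v ⬝ᵥ H *ᵥ v) [Nonempty ι] (hT0 : 0 ≤ T)
    {c : ℝ} (hc : 0 < c)
    (hT : (Real.log (w ⬝ᵥ w) - Real.log (c ^ 2)) / (2 * κ) + 4 * √(Fintype.card ι : ℝ) / c
      < γ * T) :
    ∃ t ∈ Icc 0 T, sqErr κ w (z t) ≤ c ^ 2 := by
  by_contra! hcon
  have hx0 : c ^ 2 < w ⬝ᵥ w := by
    have := hcon 0 ⟨le_rfl, hT0⟩
    rwa [h.zero, sqErr_zero] at this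
  have hc2 : 0 < c ^ 2 := by positivity
  have hv0 : 0 < w ⬝ᵥ w := hc2.trans hx0
  set d := √(Fintype.card ι : ℝ) with hd
  have hd0 : 0 < d := Real.sqrt_pos.2 (by exact_mod_cast Fintype.card_pos)
  have hlog : 0 ≤ Real.log (w ⬝ᵥ w) - Real.log (c ^ 2) :=
    sub_nonneg.2 (Real.log_le_log hc2 hx0.le)
  set A := (Real.log (w ⬝ᵥ w) - Real.log (c ^ 2)) / (2 * κ) + 4 * d / c with hA
  have hApos : 0 < A := by positivity
  have hTpos : 0 < T := hT0.lt_of_ne fun h0 => by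
    rw [← h0, mul_zero] at hT
    linarith
  -- The rate A/T spends the budget A in exactly time T, and is below γ by hypothesis.
  have hγ' : 0 < A / T := by positivity
  have hγ : A / T < γ := by rwa [div_lt_iff₀ hTpos]
  have hsq : 0 < √(w ⬝ᵥ w) := Real.sqrt_pos.2 hv0
  set t₁ := ((Real.log (w ⬝ᵥ w) - Real.log (c ^ 2)) / (2 * κ)
      + 2 * d * (1 / √(c ^ 2) - 1 / √(w ⬝ᵥ w))) / (A / T) with ht₁
  have hsc : √(c ^ 2) = c := Real.sqrt_sq hc.le
  have hcw : 1 / √(w ⬝ᵥ w) ≤ 1 / c := by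
    rw [← hsc]
    exact one_div_le_one_div_of_le (by rwa [hsc]) (Real.sqrt_le_sqrt hx0.le)
  have ht₁0 : 0 ≤ t₁ := by
    rw [ht₁, hsc]
    have := sub_nonneg.2 hcw
    positivity
  -- The square root phase uses less than half of the term 4d/c. In the time left, dissipation at
  -- rate above γ'c² removes the surplus 2dc of the potential over c²/(2κ).
  have hrem : 2 * d / c / (A / T) ≤ T - t₁ := by
    have h1 : T = A / (A / T) := by field_simp
    have h2 : T - t₁ = (A - ((Real.log (w ⬝ᵥ w) - Real.log (c ^ 2)) / (2 * κ)
      + 2 * d * (1 / √(c ^ 2) - 1 / √(w ⬝ᵥ w)))) / (A / T) := by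
      rw [ht₁, sub_div A, ← h1]
    rw [h2, hsc, hA]
    gcongr
    have : 0 < 2 * d * (1 / √(w ⬝ᵥ w)) := by positivity
    have h3 : 4 * d / c - 2 * d / c = 2 * d * (1 / c) := by ring
    linarith
  have hrem0 : 0 < 2 * d / c / (A / T) := by positivity
  have hP1 := h.potential_le_sqrt_phase hκ hH hγ' hγ hc2 hx0.le ht₁ (by linarith)
  have hP2 := le_of_hasDerivWithinAt_le_neg (hγ'.trans hγ).le
    (h.continuousOn_potential (w := w)) (fun t ht => h.hasDerivWithinAt_potential ht)
    (fun t _ => IsFlowOn.deriv_potential_le hH t)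
    (fun t ht => (hcon t ⟨ht.1, ht.2.le⟩).le) ht₁0 (by linarith) (le_refl T)
  have hlow := sqErr_div_le_potential hκ w (z T)
  have hcT := hcon T ⟨hT0, le_rfl⟩
  have h1 : c ^ 2 / (2 * κ) < sqErr κ w (z T) / (2 * κ) := by gcongr
  have hγ0 : 0 < γ := hγ'.trans hγ
  have h2 : 2 * d * c ≤ γ * c ^ 2 * (T - t₁) := by
    calc 2 * d * c = (A / T) * c ^ 2 * (2 * d / c / (A / T)) := by field_simp
      _ ≤ γ * c ^ 2 * (T - t₁) := by gcongr
  rw [hsc] at hP1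
  linarith

lemma sign_eq_of_abs_sub_lt {a b : ℝ} (h : |a - b| < |b|) :
    SignType.sign a = SignType.sign b := by
  rcases lt_trichotomy b 0 with hb | hb | hb
  · rw [abs_of_neg hb, abs_lt] at h
    rw [sign_neg hb, sign_neg (by linarith)]
  · rw [hb, abs_zero] at h
    exact absurd h (not_lt.2 (abs_nonneg _))
  · rw [abs_of_pos hb, abs_lt] at h
    rw [sign_pos hb, sign_pos (by linarith)]

/-- The restricted flow has the signs of its target at time `T`. -/
lemma IsFlowOn.sign_eq (h : IsFlowOn H (H *ᵥ w) κ T z) (hκ : 0 < κ) (hγ0 : 0 < γ)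
    (hH : ∀ v : ι → ℝ, γ * (v ⬝ᵥ v) ≤ v ⬝ᵥ H *ᵥ v) [Nonempty ι]
    {m : ℝ} (hm : 0 < m) (hw : ∀ i, m ≤ |w i|)
    (hT : (Real.log (w ⬝ᵥ w) - Real.log (m ^ 2)) / (2 * κ)
      + (4 + 2 * Real.log (Fintype.card ι)) / m ≤ γ * T) (i : ι) :
    SignType.sign (primal κ (z T) i) = SignType.sign (w i) := by
  by_contra hne
  have hcard : (1 : ℝ) ≤ Fintype.card ι := by exact_mod_cast Fintype.card_pos
  set s : ℝ := (Fintype.card ι : ℝ) with hs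
  have hs0 : 0 < s := by linarith
  have hlogs : 0 ≤ Real.log s := Real.log_nonneg hcard
  have hm2 : 0 < m ^ 2 := by positivity
  have hsv : s * m ^ 2 ≤ w ⬝ᵥ w := by
    have : ∑ _i : ι, m ^ 2 ≤ ∑ i, w i * w i := Finset.sum_le_sum fun i _ => by
      rw [← sq]
      exact sq_le_sq.2 (by rw [abs_of_pos hm]; exact hw i)
    simpa [dotProduct] using this
  have hsm : m ^ 2 ≤ s * m ^ 2 := le_mul_of_one_le_left hm2.le hcard
  have hsm0 : 0 < s * m ^ 2 := by positivity
  have hv0 : 0 < w ⬝ᵥ w := hsm0.trans_le hsv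
  have hsq : 0 < √(w ⬝ᵥ w) := Real.sqrt_pos.2 hv0
  have hd0 : 0 < √s := Real.sqrt_pos.2 hs0
  have hssm : √(s * m ^ 2) = √s * m := by rw [Real.sqrt_mul hs0.le, Real.sqrt_sq hm.le]
  -- I₁ is the cost of the square root phase from w·w down to s m², I₂ that of the linear phase down
  -- to m², and the 2/m in A pays for burning the last 2m at rate m². Their sum undercuts the
  -- hypothesis by 2√s/√(w·w), which leaves room for a rate below γ.
  set I₁ := (Real.log (w ⬝ᵥ w) - Real.log (s * m ^ 2)) / (2 * κ)
      + 2 * √s * (1 / √(s * m ^ 2) - 1 / √(w ⬝ᵥ w)) with hI₁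
  set I₂ := (1 / (2 * κ) + 2 / m) * Real.log s with hI₂
  have hI₁0 : 0 ≤ I₁ := by
    have h1 : 0 ≤ Real.log (w ⬝ᵥ w) - Real.log (s * m ^ 2) :=
      sub_nonneg.2 (Real.log_le_log hsm0 hsv)
    have h2 : 0 ≤ 1 / √(s * m ^ 2) - 1 / √(w ⬝ᵥ w) := sub_nonneg.2
      (one_div_le_one_div_of_le (Real.sqrt_pos.2 hsm0) (Real.sqrt_le_sqrt hsv))
    positivity
  have hI₂0 : 0 ≤ I₂ := by positivity
  set A := I₁ + I₂ + 2 / m with hA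
  have hApos : 0 < A := by positivity
  have hAT : A < γ * T := by
    refine lt_of_lt_of_le ?_ hT
    have h1 : √s * (1 / √(s * m ^ 2)) = 1 / m := by
      rw [hssm]
      field_simp
    have h2 : 0 < √s * (1 / √(w ⬝ᵥ w)) := by positivity
    have h3 : Real.log (s * m ^ 2) = Real.log s + Real.log (m ^ 2) :=
      Real.log_mul hs0.ne' hm2.ne'
    have h4 : (Real.log (w ⬝ᵥ w) - Real.log (m ^ 2)) / (2 * κ) + (4 + 2 * Real.log s) / m - A
        = 2 * (√s * (1 / √(w ⬝ᵥ w))) := by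
      rw [hA, hI₁, hI₂, h3, mul_assoc 2 (√s), mul_sub (√s), h1]
      field_simp
      ring
    linarith
  have hTpos : 0 < T := pos_of_mul_pos_right (hApos.trans hAT) hγ0.le
  set g := A / T with hg
  have hg0 : 0 < g := by positivity
  have hgγ : g < γ := by rwa [hg, div_lt_iff₀ hTpos]
  have hTg : T = A / g := by rw [hg]; field_simp
  set t₁ := I₁ / g with ht₁
  set t₂ := t₁ + I₂ / g with ht₂
  have ht₁0 : 0 ≤ t₁ := by positivity
  have hT2 : T - t₂ = 2 / m / g := by
    rw [hTg, ht₂, ht₁, hA]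
    ring
  have h2m : 0 < 2 / m / g := by positivity
  have hI₂g : 0 ≤ I₂ / g := by positivity
  have hbad : m ^ 2 ≤ sqErr κ w (z T) := by
    refine le_trans ?_ (sq_le_sqErr κ w (z T) i)
    refine sq_le_sq.2 ?_
    rw [abs_of_pos hm]
    refine (hw i).trans ?_
    by_contra hlt
    exact hne (sign_eq_of_abs_sub_lt (not_le.1 hlt))
  have hlow : m ^ 2 / (2 * κ) ≤ potential κ w (z T) :=
    le_trans (by gcongr) (sqErr_div_le_potential hκ w (z T))
  -- Signs cannot be lost again: once the error is below m², the potential is below m²/(2κ) and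
  -- stays there, whereas a wrong sign at T forces at least m²/(2κ).
  have hall : ∀ t ∈ Ico 0 T, m ^ 2 ≤ sqErr κ w (z t) := by
    intro t ht
    by_contra hlt
    have h1 := potential_eq_of_sqErr_lt hκ hm hw (not_le.1 hlt)
    have h2 := le_of_hasDerivWithinAt_le_neg hγ0.le
      (h.continuousOn_potential (w := w)) (fun t ht => h.hasDerivWithinAt_potential ht)
      (fun t _ => IsFlowOn.deriv_potential_le hH t)
      (fun t _ => sqErr_nonneg κ w (z t)) ht.1 ht.2.le (le_refl T)
    have h3 : sqErr κ w (z t) / (2 * κ) < m ^ 2 / (2 * κ) := by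
      gcongr
      exact not_le.1 hlt
    simp only [mul_zero, zero_mul, sub_zero] at h2
    linarith
  have hP1 := h.potential_le_sqrt_phase hκ hH hg0 hgγ hsm0 hsv ht₁ (by linarith)
  have hP2 : potential κ w (z t₂) ≤ m ^ 2 * (1 / (2 * κ) + 2 / m) := by
    have hKd : t₂ = t₁ + ((1 / (2 * κ) + 2 / m) * Real.log (s * m ^ 2)
        - (1 / (2 * κ) + 2 / m) * Real.log (m ^ 2)) / g := by
      rw [ht₂, hI₂, Real.log_mul hs0.ne' hm2.ne']
      ring
    have key := le_of_dissipation (Φ := fun s => potential κ w (z s))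
      (x := fun s => sqErr κ w (z s)) (F := fun v => v * (1 / (2 * κ) + 2 / m))
      (F' := fun v => 1 * (1 / (2 * κ) + 2 / m))
      (K := fun v => (1 / (2 * κ) + 2 / m) * Real.log v) (v₀ := s * m ^ 2) (v₁ := m ^ 2)
      (t₀ := t₁) hg0 hgγ h.continuousOn_potential (fun t ht => h.hasDerivWithinAt_potential ht)
      (fun t _ => IsFlowOn.deriv_potential_le hH t) hm2 hsm
      (fun v _ => (hasDerivAt_id v).mul_const _) (fun v _ => by positivity)
      (fun v hv => ?_) (fun t _ v _ hle => ?_) ht₁0 ?_ ?_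
    · rw [hKd]
      exact key
    · have hvpos : 0 < v := hm2.trans_le hv.1
      convert! (Real.hasDerivAt_log hvpos.ne').const_mul (1 / (2 * κ) + 2 / m) using 1
      field_simp
    · exact le_of_mul_le_mul_right (hle.trans (potential_le_linear hκ hm hw (z t)))
        (by positivity)
    -- The two upper bounds on the potential coincide at v = s m², which is why the phases switch
    -- there.
    · refine hP1.trans (le_of_eq ?_)
      rw [hssm]
      have := Real.mul_self_sqrt hs0.le
      field_simp
      linear_combination (4 * κ) * this
    · rw [← hKd]
      linarith
  have hP3 := le_of_hasDerivWithinAt_le_neg hγ0.le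
    (h.continuousOn_potential (w := w)) (fun t ht => h.hasDerivWithinAt_potential ht)
    (fun t _ => IsFlowOn.deriv_potential_le hH t) hall (by positivity : 0 ≤ t₂) (by linarith)
    (le_refl T)
  have h5 : 2 * m < γ * m ^ 2 * (T - t₂) := by
    rw [hT2]
    calc 2 * m = g * m ^ 2 * (2 / m / g) := by field_simp
      _ < γ * m ^ 2 * (2 / m / g) := by gcongr
  have h6 : m ^ 2 * (1 / (2 * κ) + 2 / m) = m ^ 2 / (2 * κ) + 2 * m := by field_simp
  linarith

end Restricted

/-! ### Norms -/

section Norms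

variable {ι : Type*} [Fintype ι]

lemma l2norm_nonneg (v : ι → ℝ) : 0 ≤ l2norm v := norm_nonneg _

lemma l2norm_eq_sqrt (v : ι → ℝ) : l2norm v = √(v ⬝ᵥ v) := by
  rw [l2norm, EuclideanSpace.norm_eq]
  simp [dotProduct, sq]

lemma dotProduct_self_nonneg' (v : ι → ℝ) : 0 ≤ v ⬝ᵥ v :=
  Finset.sum_nonneg fun i _ => mul_self_nonneg (v i)

lemma l2norm_sq (v : ι → ℝ) : l2norm v ^ 2 = v ⬝ᵥ v := by
  rw [l2norm_eq_sqrt, Real.sq_sqrt (dotProduct_self_nonneg' v)]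

lemma l2norm_add_le (u v : ι → ℝ) : l2norm (u + v) ≤ l2norm u + l2norm v := by
  rw [l2norm, WithLp.toLp_add]
  exact norm_add_le _ _

lemma abs_le_l2norm (v : ι → ℝ) (i : ι) : |v i| ≤ l2norm v := by
  have := PiLp.norm_apply_le (WithLp.toLp 2 v) i
  simpa [l2norm] using this

lemma l2norm_le_of_forall_abs_le {v : ι → ℝ} {c : ℝ} (hc : 0 ≤ c) (h : ∀ i, |v i| ≤ c) :
    l2norm v ≤ √(Fintype.card ι : ℝ) * c := by
  rw [l2norm_eq_sqrt]
  refine Real.sqrt_le_iff.2 ⟨by positivity, ?_⟩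
  rw [mul_pow, Real.sq_sqrt (Nat.cast_nonneg _)]
  have : ∑ i, v i * v i ≤ ∑ _i : ι, c ^ 2 := Finset.sum_le_sum fun i _ => by
    rw [← sq]
    exact sq_le_sq.2 (by rw [abs_of_nonneg hc]; exact h i)
  simpa [dotProduct] using this

lemma sum_abs_le_matInfNorm {κ : Type*} [Fintype κ] (M : Matrix κ ι ℝ) (i : κ) :
    ∑ j, |M i j| ≤ matInfNorm M := by
  have h : matInfNorm M = ((Finset.univ.sup fun i => ∑ j, ‖M i j‖₊ : ℝ≥0) : ℝ) :=
    Matrix.linfty_opNorm_def M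
  have h2 : ∑ j, ‖M i j‖₊ ≤ Finset.univ.sup fun i => ∑ j, ‖M i j‖₊ :=
    Finset.le_sup (f := fun i => ∑ j, ‖M i j‖₊) (Finset.mem_univ i)
  rw [h]
  have h3 := NNReal.coe_le_coe.2 h2
  simpa using h3

lemma abs_mulVec_le {κ : Type*} [Fintype κ] (M : Matrix κ ι ℝ) {v : ι → ℝ} {c : ℝ}
    (hc : 0 ≤ c) (h : ∀ j, |v j| ≤ c) (i : κ) : |(M *ᵥ v) i| ≤ matInfNorm M * c := by
  calc |(M *ᵥ v) i| ≤ ∑ j, |M i j * v j| := Finset.abs_sum_le_sum_abs _ _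
    _ ≤ ∑ j, |M i j| * c := Finset.sum_le_sum fun j _ => by
        rw [abs_mul]
        exact mul_le_mul_of_nonneg_left (h j) (abs_nonneg _)
    _ = (∑ j, |M i j|) * c := by rw [Finset.sum_mul]
    _ ≤ matInfNorm M * c := mul_le_mul_of_nonneg_right (sum_abs_le_matInfNorm M i) hc

end Norms

/-! ### Design matrix, least squares, and extension of the restricted flow off S. -/

section Design

variable {n p : ℕ} {X : Matrix (Fin n) (Fin p) ℝ} {S : Finset (Fin p)} {γ : ℝ}

lemma mulVec_eq_cols_mulVec {β : Fin p → ℝ} (h : ∀ i ∉ S, β i = 0) :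
    X *ᵥ β = cols X S *ᵥ fun i : S => β i := by
  funext k
  simp only [Matrix.mulVec, dotProduct, cols, Matrix.submatrix_apply, id]
  rw [Finset.sum_coe_sort S (fun i => X k i * β i)]
  refine (Finset.sum_subset (Finset.subset_univ S) fun i _ hi => ?_).symm
  rw [h i hi, mul_zero]

lemma l2norm_eq_l2norm_restrict {v : Fin p → ℝ} (h : ∀ i ∉ S, v i = 0) :
    l2norm v = l2norm fun i : S => v i := by
  rw [l2norm_eq_sqrt, l2norm_eq_sqrt]
  congr 1
  simp only [dotProduct]
  rw [Finset.sum_coe_sort S (fun i => v i * v i)]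
  refine (Finset.sum_subset (Finset.subset_univ S) fun i _ hi => ?_).symm
  rw [h i hi, mul_zero]

lemma gram_isSymm : (gram X S).IsSymm := by
  rw [gram, adj, Matrix.smul_mul, Matrix.IsSymm, Matrix.transpose_smul, Matrix.transpose_mul,
    Matrix.transpose_transpose]

lemma dotProduct_gram_mulVec (v : S → ℝ) :
    v ⬝ᵥ gram X S *ᵥ v = (cols X S *ᵥ v) ⬝ᵥ (cols X S *ᵥ v) / n := by
  rw [gram, adj, Matrix.smul_mul, Matrix.smul_mulVec, dotProduct_smul, ← Matrix.mulVec_mulVec,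
    Matrix.dotProduct_mulVec, Matrix.vecMul_transpose, smul_eq_mul]
  ring

lemma RestrictedStrongConvexity.le_dotProduct (h : RestrictedStrongConvexity X S γ)
    (v : S → ℝ) : γ * (v ⬝ᵥ v) ≤ v ⬝ᵥ gram X S *ᵥ v := by
  have := h.2.2.dotProduct_mulVec_nonneg v
  simp only [star_trivial, Matrix.sub_mulVec, Matrix.smul_mulVec, Matrix.one_mulVec,
    dotProduct_sub, dotProduct_smul, smul_eq_mul] at this
  linarith

lemma RestrictedStrongConvexity.isUnit_det (h : RestrictedStrongConvexity X S γ) :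
    IsUnit (gram X S).det := by
  rw [← Matrix.isUnit_iff_isUnit_det, ← Matrix.mulVec_injective_iff_isUnit]
  refine (injective_iff_map_eq_zero (Matrix.mulVecLin (gram X S))).2 fun v hv => ?_
  have h1 := h.le_dotProduct v
  rw [show gram X S *ᵥ v = 0 from hv, dotProduct_zero] at h1
  have h2 : v ⬝ᵥ v = 0 :=
    le_antisymm (nonpos_of_mul_nonpos_right h1 h.1) (dotProduct_self_nonneg' v)
  exact dotProduct_self_eq_zero.1 h2

/-- The least squares coefficients of `e` on the columns in `S`. -/
noncomputable def lsq (X : Matrix (Fin n) (Fin p) ℝ) (S : Finset (Fin p)) (e : Fin n → ℝ) :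
    S → ℝ := (gram X S)⁻¹ *ᵥ (adj (cols X S) *ᵥ e)

/-- The least squares residual of `e`. -/
noncomputable def resid (X : Matrix (Fin n) (Fin p) ℝ) (S : Finset (Fin p)) (e : Fin n → ℝ) :
    Fin n → ℝ := e - cols X S *ᵥ lsq X S e

lemma adj_mulVec_resid (h : IsUnit (gram X S).det) (e : Fin n → ℝ) :
    adj (cols X S) *ᵥ resid X S e = 0 := by
  rw [resid, Matrix.mulVec_sub, Matrix.mulVec_mulVec, lsq, ← gram, Matrix.mulVec_mulVec,
    Matrix.mul_nonsing_inv _ h, Matrix.one_mulVec, sub_self]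

/-- The extension of a restricted flow to all coordinates. -/
noncomputable def extendFlow (X : Matrix (Fin n) (Fin p) ℝ) (S : Finset (Fin p))
    (e : Fin n → ℝ) (z : ℝ → S → ℝ) (t : ℝ) : Fin p → ℝ :=
  (adj X * cols X S * (gram X S)⁻¹) *ᵥ z t + t • (adj X *ᵥ resid X S e)

lemma extendFlow_of_mem (h : IsUnit (gram X S).det) (e : Fin n → ℝ) (z : ℝ → S → ℝ) (t : ℝ)
    (i : S) : extendFlow X S e z t i = z t i := by
  have h1 : ((adj X * cols X S * (gram X S)⁻¹) *ᵥ z t) i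
      = ((adj (cols X S) * cols X S * (gram X S)⁻¹) *ᵥ z t) i := rfl
  have h2 : (adj X *ᵥ resid X S e) i = (adj (cols X S) *ᵥ resid X S e) i := rfl
  rw [extendFlow, Pi.add_apply, Pi.smul_apply, h1, h2, adj_mulVec_resid h, ← gram,
    Matrix.mul_nonsing_inv _ h, Matrix.one_mulVec]
  simp

lemma abs_extendFlow_le {η : ℝ} (hη : Irrepresentable X S η) (e : Fin n → ℝ)
    {z : ℝ → S → ℝ} {t c N : ℝ} (ht : 0 ≤ t) (hc : 0 ≤ c) (hz : ∀ i, |z t i| ≤ c) {j : Fin p}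
    (hj : j ∉ S) (hN : |(adj X *ᵥ resid X S e) j| ≤ N) :
    |extendFlow X S e z t j| ≤ (1 - η) * c + t * N := by
  have hj' : j ∈ Sᶜ := Finset.mem_compl.2 hj
  have h1 : |((adj X * cols X S * (gram X S)⁻¹) *ᵥ z t) j| ≤ (1 - η) * c := by
    have := abs_mulVec_le (adj (cols X Sᶜ) * cols X S * (gram X S)⁻¹) hc hz ⟨j, hj'⟩
    refine le_trans (le_of_eq rfl) (this.trans ?_)
    exact mul_le_mul_of_nonneg_right hη.2.2 hc
  rw [extendFlow, Pi.add_apply, Pi.smul_apply, smul_eq_mul]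
  refine (abs_add_le _ _).trans (add_le_add h1 ?_)
  rw [abs_mul, abs_of_nonneg ht]
  exact mul_le_mul_of_nonneg_left hN ht

/-- Thresholding kills the coordinates off S, so X sees only the restricted β. The data split as
X_S(b + `lsq`) plus the residual, matching the two terms of `extendFlow`. -/
lemma isFlowOn_extendFlow (h : IsUnit (gram X S).det) {b : S → ℝ} {e : Fin n → ℝ} {κ T : ℝ}
    {z : ℝ → S → ℝ} (hz : IsFlowOn (gram X S) (gram X S *ᵥ (b + lsq X S e)) κ T z)
    (hoff : ∀ t ∈ Icc 0 T, ∀ j ∉ S, |extendFlow X S e z t j| ≤ 1) :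
    IsFlowOn (adj X * X) (adj X *ᵥ (cols X S *ᵥ b + e)) κ T (extendFlow X S e z) where
  zero := by simp [extendFlow, hz.zero]
  cont := by
    have h1 : Continuous fun v : S → ℝ => (adj X * cols X S * (gram X S)⁻¹) *ᵥ v :=
      (LinearMap.toContinuousLinearMap
        (Matrix.mulVecLin (adj X * cols X S * (gram X S)⁻¹))).continuous
    exact (h1.comp_continuousOn hz.cont).add (continuousOn_id.smul continuousOn_const)
  deriv := fun t ht => by
    have h1 := (hasDerivWithinAt_mulVec (adj X * cols X S * (gram X S)⁻¹) (hz.deriv t ht)).add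
      ((hasDerivWithinAt_id t (Ici t)).smul_const (adj X *ᵥ resid X S e))
    have h2 : X *ᵥ primal κ (extendFlow X S e z t) = cols X S *ᵥ primal κ (z t) := by
      rw [mulVec_eq_cols_mulVec (S := S)]
      · congr 1
        funext i
        rw [primal, primal, extendFlow_of_mem h]
      · intro j hj
        rw [primal, shrink_of_abs_le (hoff t ⟨ht.1, ht.2.le⟩ j hj), mul_zero]
    have h3 : ∀ v : S → ℝ, (adj X * cols X S * (gram X S)⁻¹) *ᵥ (gram X S *ᵥ v)
        = adj X *ᵥ (cols X S *ᵥ v) := fun v => by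
      rw [Matrix.mulVec_mulVec, Matrix.nonsing_inv_mul_cancel_right _ _ h, Matrix.mulVec_mulVec]
    convert! h1 using 1
    rw [← Matrix.mulVec_mulVec, h2, ← Matrix.mulVec_sub, ← Matrix.mulVec_sub, h3, one_smul,
      ← Matrix.mulVec_add, resid]
    congr 1
    rw [Matrix.mulVec_sub, Matrix.mulVec_add]
    abel

/-- As long as the extended restricted flow stays small off `S`, it carries every path. -/
lemma IsPath.eq_restricted {b : S → ℝ} {e : Fin n → ℝ} {κ T : ℝ} (hκ : 0 < κ)
    (h : IsUnit (gram X S).det) {z : ℝ → S → ℝ}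
    (hz : IsFlowOn (gram X S) (gram X S *ᵥ (b + lsq X S e)) κ T z)
    (hoff : ∀ t ∈ Icc 0 T, ∀ j ∉ S, |extendFlow X S e z t j| ≤ 1) {ρ β : ℝ → Fin p → ℝ}
    (hp : IsPath X (cols X S *ᵥ b + e) κ ρ β) {t : ℝ} (ht : t ∈ Icc 0 T) :
    (∀ i : S, β t i = primal κ (z t) i) ∧ ∀ j ∉ S, β t j = 0 := by
  have h1 := (hp.isFlowOn hκ T).eqOn (isFlowOn_extendFlow h hz hoff) ht
  have h2 := hp.primal_eq hκ ht.1
  simp only at h1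
  rw [h1] at h2
  refine ⟨fun i => ?_, fun j hj => ?_⟩
  · rw [← h2, primal, primal, extendFlow_of_mem h]
  · rw [← h2, primal, shrink_of_abs_le (hoff t ht j hj), mul_zero]

end Design

/-! ### Consistency for well-behaved noise -/

section Magnitudes

variable {p : ℕ} {b : Fin p → ℝ}

lemma mem_supp {i : Fin p} : i ∈ supp b ↔ b i ≠ 0 := by simp [supp]

lemma notMem_supp {i : Fin p} : i ∉ supp b ↔ b i = 0 := by simp [supp]

lemma nonempty_supp (hb : b ≠ 0) : Nonempty (supp b) := by
  obtain ⟨i, hi⟩ := Function.ne_iff.1 hb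
  exact ⟨⟨i, mem_supp.2 hi⟩⟩

lemma abs_le_maxMag (i : supp b) : |b i| ≤ maxMag b :=
  le_ciSup (f := fun i : supp b => |b i|) (Set.finite_range _).bddAbove i

lemma minMag_le_abs (i : supp b) : minMag b ≤ |b i| :=
  ciInf_le (f := fun i : supp b => |b i|) (Set.finite_range _).bddBelow i

lemma minMag_pos (hb : b ≠ 0) : 0 < minMag b := by
  have := nonempty_supp hb
  obtain ⟨i, hi⟩ := exists_eq_ciInf_of_finite (f := fun i : supp b => |b i|)
  rw [minMag, ← hi]
  exact abs_pos.2 (mem_supp.1 i.2)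

end Magnitudes

variable {n p : ℕ} {X : Matrix (Fin n) (Fin p) ℝ} {βstar : Fin p → ℝ} {σ γ η κ : ℝ}
  {e : Fin n → ℝ}

/-- The noise realizations for which the path is consistent. -/
structure GoodNoise (X : Matrix (Fin n) (Fin p) ℝ) (βstar : Fin p → ℝ) (σ γ : ℝ)
    (e : Fin n → ℝ) : Prop where
  off : ∀ j ∉ supp βstar, |(adj X *ᵥ resid X (supp βstar) e) j|
    ≤ 2 * σ * √(Real.log p / n) * maxOffCol X βstar
  on : ∀ i, |lsq X (supp βstar) e i| ≤ 2 * σ * √(Real.log p / (γ * n))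
  fit : l2norm (cols X (supp βstar) *ᵥ lsq X (supp βstar) e)
    ≤ 2 * σ * √((supp βstar).card * Real.log n)

/-- The target of the restricted flow. -/
noncomputable def oracle (X : Matrix (Fin n) (Fin p) ℝ) (βstar : Fin p → ℝ) (e : Fin n → ℝ) :
    supp βstar → ℝ := fun i => βstar i + lsq X (supp βstar) e i

lemma oracle_apply (i : supp βstar) :
    oracle X βstar e i = βstar i + lsq X (supp βstar) e i := rfl

lemma oracle_eq_add :
    oracle X βstar e = (fun i : supp βstar => βstar i) + lsq X (supp βstar) e := rfl

lemma mulVec_eq_cols_supp :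
    X *ᵥ βstar = cols X (supp βstar) *ᵥ fun i : supp βstar => βstar i :=
  mulVec_eq_cols_mulVec fun _ hi => notMem_supp.1 hi

/-- Strong convexity and energy decay give γ‖β - w‖² ≤ ‖X_S w‖²/n, the last summand of B; the other
two bound |w_i|. -/
lemma GoodNoise.abs_primal_le_constB (hg : GoodNoise X βstar σ γ e) (hn : 0 < n)
    (hA1 : RestrictedStrongConvexity X (supp βstar) γ) (hκ : 0 < κ) {T : ℝ}
    {z : ℝ → supp βstar → ℝ}
    (hz : IsFlowOn (gram X (supp βstar)) (gram X (supp βstar) *ᵥ oracle X βstar e) κ T z)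
    {t : ℝ} (ht : t ∈ Icc 0 T) (i : supp βstar) :
    |primal κ (z t) i| ≤ constB X βstar σ γ := by
  have hn' : (0 : ℝ) < n := by exact_mod_cast hn
  have hγ := hA1.1
  set w := oracle X βstar e with hw
  set a := l2norm (X *ᵥ βstar) + 2 * σ * √((supp βstar).card * Real.log n) with ha
  have hfit : l2norm (cols X (supp βstar) *ᵥ w) ≤ a := by
    rw [hw, oracle_eq_add, Matrix.mulVec_add, ← mulVec_eq_cols_supp]
    exact (l2norm_add_le _ _).trans (by rw [ha]; gcongr; exact hg.fit)
  have ha0 : 0 ≤ a := (l2norm_nonneg _).trans hfit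
  have h1 : (primal κ (z t) i - w i) ^ 2 ≤ a ^ 2 / (n * γ) := by
    refine (sq_le_sqErr κ w (z t) i).trans ?_
    rw [le_div_iff₀ (by positivity), sqErr_eq_dotProduct]
    have h2 := (hA1.le_dotProduct _).trans (hz.energy_le gram_isSymm hκ.le ht)
    rw [dotProduct_gram_mulVec, le_div_iff₀ hn',
      ← l2norm_sq (cols X (supp βstar) *ᵥ w)] at h2
    have h3 : l2norm (cols X (supp βstar) *ᵥ w) ^ 2 ≤ a ^ 2 :=
      pow_le_pow_left₀ (l2norm_nonneg _) hfit 2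
    linarith
  have h2 : |primal κ (z t) i - w i| ≤ a / √(n * γ) := by
    have := Real.abs_le_sqrt h1
    rwa [Real.sqrt_div (sq_nonneg a), Real.sqrt_sq ha0] at this
  have h3 : |w i| ≤ maxMag βstar + 2 * σ * √(Real.log p / (γ * n)) := by
    rw [hw, oracle_apply]
    exact (abs_add_le _ _).trans (add_le_add (abs_le_maxMag i) (hg.on i))
  have h4 : |primal κ (z t) i| ≤ |w i| + |primal κ (z t) i - w i| := by
    have := abs_add_le (w i) (primal κ (z t) i - w i)
    rwa [add_sub_cancel] at this
  rw [constB]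
  linarith

lemma abs_flow_le {ι : Type*} {z : ι → ℝ} {B : ℝ} (hκ : 0 < κ) (h : ∀ i, |primal κ z i| ≤ B)
    (i : ι) : |z i| ≤ 1 + B / κ := by
  have h1 := h i
  rw [primal, abs_mul, abs_of_pos hκ, mul_comm, ← le_div_iff₀ hκ] at h1
  have h2 := abs_sub_shrink_le (z i)
  have h3 := abs_add_le (z i - shrink (z i)) (shrink (z i))
  rw [sub_add_cancel] at h3
  linarith

lemma tauBar_mul (hn : 0 < n) (hp : 0 < Real.log p) (hσ : 0 < σ) :
    tauBar X βstar σ γ η κ * (2 * σ * √(Real.log p / n))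
      = (1 - constB X βstar σ γ / (κ * η)) * η * (maxOffCol X βstar)⁻¹ := by
  have hn' : (0 : ℝ) < n := by exact_mod_cast hn
  have h : √((n : ℝ) / Real.log p) * √(Real.log p / n) = 1 := by
    rw [← Real.sqrt_mul (by positivity)]
    have : (n : ℝ) / Real.log p * (Real.log p / n) = 1 := by field_simp
    rw [this, Real.sqrt_one]
  rw [tauBar]
  calc _ = (1 - constB X βstar σ γ / (κ * η)) * η / (2 * σ) * (2 * σ)
        * (√((n : ℝ) / Real.log p) * √(Real.log p / n)) * (maxOffCol X βstar)⁻¹ := by ring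
    _ = _ := by
      rw [h, div_mul_cancel₀ _ (by positivity)]
      ring

lemma tauBar_nonneg (hκ : 0 < κ) (hη : 0 < η) (hσ : 0 < σ) (hM : 0 < maxOffCol X βstar)
    (hB : constB X βstar σ γ ≤ κ * η) : 0 ≤ tauBar X βstar σ γ η κ := by
  have h1 : constB X βstar σ γ / (κ * η) ≤ 1 := (div_le_one (by positivity)).2 hB
  have h2 := sub_nonneg.2 h1
  rw [tauBar]
  positivity

/-- Up to time `τ̄` every path is carried by the restricted flow. -/
lemma GoodNoise.exists_restricted (hg : GoodNoise X βstar σ γ e) (hn : 0 < n)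
    (hp : 0 < Real.log p) (hβ : βstar ≠ 0) (hσ : 0 < σ) (hM : 0 < maxOffCol X βstar)
    (hA1 : RestrictedStrongConvexity X (supp βstar) γ)
    (hA2 : Irrepresentable X (supp βstar) η) (hκ : 0 < κ)
    {ρ β : ℝ → Fin p → ℝ} (hpath : IsPath X (X *ᵥ βstar + e) κ ρ β) :
    ∃ z : ℝ → supp βstar → ℝ,
      IsFlowOn (gram X (supp βstar)) (gram X (supp βstar) *ᵥ oracle X βstar e) κ
        (tauBar X βstar σ γ η κ) z ∧
      ∀ t ∈ Icc 0 (tauBar X βstar σ γ η κ),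
        (∀ i : supp βstar, β t i = primal κ (z t) i) ∧ ∀ j ∉ supp βstar, β t j = 0 := by
  obtain ⟨z, hz0, hz⟩ := exists_flow (gram X (supp βstar))
    (gram X (supp βstar) *ᵥ oracle X βstar e) κ
  have hflow := isFlowOn_of_hasDerivWithinAt hz0 hz (tauBar X βstar σ γ η κ)
  refine ⟨z, hflow, fun t ht => ?_⟩
  rw [mulVec_eq_cols_supp] at hpath
  refine hpath.eq_restricted (b := fun i : supp βstar => βstar i) hκ hA1.isUnit_det hflow (fun t ht j hj => ?_) ht
  obtain ⟨i⟩ := nonempty_supp hβ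
  have hB0 : 0 ≤ constB X βstar σ γ :=
    (abs_nonneg _).trans (hg.abs_primal_le_constB hn hA1 hκ hflow ht i)
  have hzt := abs_flow_le hκ (hg.abs_primal_le_constB hn hA1 hκ hflow ht)
  refine (abs_extendFlow_le hA2 e ht.1 (by positivity) hzt hj (hg.off j hj)).trans ?_
  have hη := hA2.1
  -- τ̄ is defined so that the residual drift is at most η - B/κ. Added to (1 - η)(1 + B/κ) this
  -- leaves 1 - ηB/κ ≤ 1.
  have h1 : t * (2 * σ * √(Real.log p / n) * maxOffCol X βstar)
      ≤ η - constB X βstar σ γ / κ := by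
    calc t * (2 * σ * √(Real.log p / n) * maxOffCol X βstar)
        ≤ tauBar X βstar σ γ η κ * (2 * σ * √(Real.log p / n) * maxOffCol X βstar) :=
          mul_le_mul_of_nonneg_right ht.2 (by positivity)
      _ = tauBar X βstar σ γ η κ * (2 * σ * √(Real.log p / n)) * maxOffCol X βstar := by ring
      _ = η - constB X βstar σ γ / κ := by
        rw [tauBar_mul hn hp hσ]
        field_simp
  have h2 : 0 ≤ η * (constB X βstar σ γ / κ) := by positivity
  linarith

lemma sqrt_log_div_eq (hp : 0 < Real.log p) (hn : 0 < n) (hγ : 0 < γ) :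
    √(Real.log p / (γ * n)) = √(Real.log p / n) / √γ := by
  have hn' : (0 : ℝ) < n := by exact_mod_cast hn
  rw [← Real.sqrt_div (by positivity)]
  congr 1
  field_simp

/-- Sign consistency of the mean path. -/
lemma GoodNoise.sameSign_meanPath (hg : GoodNoise X βstar σ γ e) (hn : 0 < n)
    (hp : 0 < Real.log p) (hβ : βstar ≠ 0) (hσ : 0 < σ) (hM : 0 < maxOffCol X βstar)
    (hA1 : RestrictedStrongConvexity X (supp βstar) γ)
    (hA2 : Irrepresentable X (supp βstar) η) (hκ : 0 < κ)
    {β : ℝ → Fin p → ℝ} {z : ℝ → supp βstar → ℝ}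
    (hz : IsFlowOn (gram X (supp βstar)) (gram X (supp βstar) *ᵥ oracle X βstar e) κ
        (tauBar X βstar σ γ η κ) z)
    (hβz : ∀ t ∈ Icc 0 (tauBar X βstar σ γ η κ),
        (∀ i : supp βstar, β t i = primal κ (z t) i) ∧ ∀ j ∉ supp βstar, β t j = 0)
    (hβc : ContinuousOn β (Ici 0)) (hτ : 0 < tauBar X βstar σ γ η κ)
    (hmin : constC1 X βstar σ γ η κ / tauBar X βstar σ γ η κ < minMag βstar) :
    SameSign (meanPath β (tauBar X βstar σ γ η κ)) βstar := by
  have := nonempty_supp hβ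
  have hn' : (0 : ℝ) < n := by exact_mod_cast hn
  have hγ := hA1.1
  have hη := hA2.1
  have hη1 := hA2.2.1
  set T := tauBar X βstar σ γ η κ with hTdef
  set H := gram X (supp βstar) with hH
  set w := oracle X βstar e with hw
  have hproj : ∀ {q : ℕ} (f : ℝ → Fin q → ℝ) (i : Fin q), ContinuousOn f (Icc 0 T) →
      (∫ s in (0 : ℝ)..T, f s) i = ∫ s in (0 : ℝ)..T, f s i := by
    intro q f i hf
    have := (ContinuousLinearMap.proj (R := ℝ) (φ := fun _ : Fin q => ℝ) i).intervalIntegral_comp_comm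
      (hf.intervalIntegrable_of_Icc (μ := volume) hτ.le)
    simpa using this.symm
  have hproj' : ∀ (f : ℝ → supp βstar → ℝ) (i), ContinuousOn f (Icc 0 T) →
      (∫ s in (0 : ℝ)..T, f s) i = ∫ s in (0 : ℝ)..T, f s i := by
    intro f i hf
    have := (ContinuousLinearMap.proj (R := ℝ)
      (φ := fun _ : supp βstar => ℝ) i).intervalIntegral_comp_comm
      (hf.intervalIntegrable_of_Icc (μ := volume) hτ.le)
    simpa using this.symm
  have hβc' : ContinuousOn β (Icc 0 T) := hβc.mono Icc_subset_Ici_self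
  have hpc : ContinuousOn (fun s => primal κ (z s)) (Icc 0 T) := continuousOn_primal hz.cont
  have hmean : ∀ i, meanPath β T i = 1 / T * ∫ s in (0 : ℝ)..T, β s i := fun i => by
    rw [meanPath, Pi.smul_apply, smul_eq_mul, hproj β i hβc']
  set J := ∫ s in (0 : ℝ)..T, primal κ (z s) with hJ
  have hFTC : z T = T • (H *ᵥ w) - H *ᵥ J := by
    have hL : H *ᵥ J = ∫ s in (0 : ℝ)..T, H *ᵥ primal κ (z s) :=
      ((LinearMap.toContinuousLinearMap (Matrix.mulVecLin H)).intervalIntegral_comp_comm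
        (hpc.intervalIntegrable_of_Icc (μ := volume) hτ.le)).symm
    have hHc : ContinuousOn (fun s => H *ᵥ primal κ (z s)) (Icc 0 T) :=
      (LinearMap.toContinuousLinearMap (Matrix.mulVecLin H)).continuous.comp_continuousOn hpc
    have h1 : ∫ s in (0 : ℝ)..T, (H *ᵥ w - H *ᵥ primal κ (z s)) = z T - z 0 := by
      refine intervalIntegral.integral_eq_sub_of_hasDeriv_right (by rw [uIcc_of_le hτ.le]; exact hz.cont)
        (fun s hs => ?_) ?_
      · rw [min_eq_left hτ.le, max_eq_right hτ.le] at hs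
        exact (hz.deriv s ⟨hs.1.le, hs.2⟩).mono Ioi_subset_Ici_self
      · exact ContinuousOn.intervalIntegrable_of_Icc hτ.le (continuousOn_const.sub hHc)
    rw [intervalIntegral.integral_sub intervalIntegrable_const
      (hHc.intervalIntegrable_of_Icc hτ.le), intervalIntegral.integral_const, sub_zero, ← hL,
      hz.zero, sub_zero] at h1
    exact h1.symm
  have hJw : J = T • w - H⁻¹ *ᵥ z T := by
    rw [hFTC, Matrix.mulVec_sub, Matrix.mulVec_smul, Matrix.mulVec_mulVec, Matrix.mulVec_mulVec,
      Matrix.nonsing_inv_mul _ hA1.isUnit_det, Matrix.one_mulVec, Matrix.one_mulVec]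
    abel
  have hB := hg.abs_primal_le_constB hn hA1 hκ hz (t := T) ⟨hτ.le, le_rfl⟩
  have hB0 : 0 ≤ constB X βstar σ γ :=
    (abs_nonneg _).trans (hB (Classical.arbitrary _))
  intro j
  rw [hmean]
  by_cases hj : j ∈ supp βstar
  · have h1 : ∫ s in (0 : ℝ)..T, β s j = J ⟨j, hj⟩ := by
      rw [hJ, hproj' _ _ hpc]
      refine intervalIntegral.integral_congr fun s hs => ?_
      rw [uIcc_of_le hτ.le] at hs
      exact (hβz s hs).1 ⟨j, hj⟩
    rw [h1]
    refine sign_eq_of_abs_sub_lt ?_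
    refine lt_of_le_of_lt ?_ (hmin.trans_le (minMag_le_abs ⟨j, hj⟩))
    have h2 : 1 / T * J ⟨j, hj⟩ - βstar j
        = lsq X (supp βstar) e ⟨j, hj⟩ - 1 / T * (H⁻¹ *ᵥ z T) ⟨j, hj⟩ := by
      rw [hJw, Pi.sub_apply, Pi.smul_apply, smul_eq_mul, hw, oracle_apply]
      field_simp
      ring
    have h3 : |(H⁻¹ *ᵥ z T) ⟨j, hj⟩| ≤ matInfNorm H⁻¹ * (1 + constB X βstar σ γ / (κ * η)) := by
      have hle : constB X βstar σ γ / κ ≤ constB X βstar σ γ / (κ * η) := by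
        refine div_le_div_of_nonneg_left hB0 (by positivity) ?_
        exact mul_le_of_le_one_right hκ.le hη1.le
      exact abs_mulVec_le H⁻¹ (by positivity)
        (fun i => (abs_flow_le hκ hB i).trans (by linarith)) ⟨j, hj⟩
    -- The noise bound on S is exactly the first summand of c₁ divided by τ̄.
    have h4 : 2 * σ * √(Real.log p / (γ * n))
        = 1 / T * ((1 - constB X βstar σ γ / (κ * η)) * η / (√γ * maxOffCol X βstar)) := by
      have h5 := tauBar_mul (X := X) (βstar := βstar) (γ := γ) (η := η) (κ := κ) hn hp hσ
      rw [← hTdef] at h5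
      have hsγ : 0 < √γ := Real.sqrt_pos.2 hγ
      rw [sqrt_log_div_eq hp hn hγ]
      calc 2 * σ * (√(Real.log p / n) / √γ)
          = 1 / T * (T * (2 * σ * √(Real.log p / n))) / √γ := by field_simp
        _ = _ := by
          rw [h5]
          field_simp
    rw [h2]
    refine (abs_sub _ _).trans ?_
    rw [abs_mul, abs_of_pos (by positivity : 0 < 1 / T), constC1]
    calc |lsq X (supp βstar) e ⟨j, hj⟩| + 1 / T * |(H⁻¹ *ᵥ z T) ⟨j, hj⟩|
        ≤ 1 / T * ((1 - constB X βstar σ γ / (κ * η)) * η / (√γ * maxOffCol X βstar))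
          + 1 / T * (matInfNorm H⁻¹ * (1 + constB X βstar σ γ / (κ * η))) := by
          gcongr
          rw [← h4]
          exact hg.on _
      _ = _ := by rw [hH]; ring
  · have h1 : ∫ s in (0 : ℝ)..T, β s j = 0 := by
      rw [intervalIntegral.integral_congr (g := fun _ => (0 : ℝ)), intervalIntegral.integral_zero]
      intro s hs
      rw [uIcc_of_le hτ.le] at hs
      exact (hβz s hs).2 j hj
    rw [h1, mul_zero, notMem_supp.1 hj]

/-- Sign consistency of the path. -/
lemma GoodNoise.sameSign (hg : GoodNoise X βstar σ γ e) (hn : 0 < n)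
    (hp : 0 < Real.log p) (hβ : βstar ≠ 0)
    (hA1 : RestrictedStrongConvexity X (supp βstar) γ) (hκ : 0 < κ) {T : ℝ} (hT0 : 0 ≤ T)
    {β : ℝ → Fin p → ℝ} {z : ℝ → supp βstar → ℝ}
    (hz : IsFlowOn (gram X (supp βstar)) (gram X (supp βstar) *ᵥ oracle X βstar e) κ T z)
    (hβz : ∀ t ∈ Icc 0 T,
        (∀ i : supp βstar, β t i = primal κ (z t) i) ∧ ∀ j ∉ supp βstar, β t j = 0)
    (hmin : 4 * σ / √γ * √(Real.log p / n) ≤ minMag βstar)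
    (hT : (8 + 4 * Real.log (supp βstar).card) / (γ * minMag βstar)
      + 1 / (κ * γ) * Real.log (3 * l2norm βstar / minMag βstar) ≤ T) :
    SameSign (β T) βstar := by
  have := nonempty_supp hβ
  have hγ := hA1.1
  set μ := minMag βstar with hμ
  have hμ0 : 0 < μ := minMag_pos hβ
  -- The signal strength condition makes the noise at most half the smallest signal. So w has the
  -- signs of β*, entries of size at least μ/2, and norm at most 3/2 that of β*; this is the source
  -- of the 3 in the logarithm.
  have hu : ∀ i, |lsq X (supp βstar) e i| ≤ μ / 2 := fun i => by
    refine (hg.on i).trans ?_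
    rw [sqrt_log_div_eq hp hn hγ]
    have : 2 * σ * (√(Real.log p / n) / √γ) = 4 * σ / √γ * √(Real.log p / n) / 2 := by ring
    linarith
  have hsign : ∀ i : supp βstar,
      SignType.sign (oracle X βstar e i) = SignType.sign (βstar i) := fun i => by
    refine sign_eq_of_abs_sub_lt ?_
    rw [oracle_apply, add_sub_cancel_left]
    have := hu i
    have h2 := minMag_le_abs i
    linarith
  have hw : ∀ i, μ / 2 ≤ |oracle X βstar e i| := fun i => by
    have h1 := hu i
    have h2 := minMag_le_abs i
    have h3 := abs_sub_abs_le_abs_sub (βstar i) (-lsq X (supp βstar) e i)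
    rw [abs_neg, sub_neg_eq_add] at h3
    rw [oracle_apply]
    linarith
  intro j
  by_cases hj : j ∈ supp βstar
  · rw [(hβz T ⟨hT0, le_rfl⟩).1 ⟨j, hj⟩, ← hsign ⟨j, hj⟩]
    refine hz.sign_eq hκ hγ hA1.le_dotProduct (half_pos hμ0) hw ?_ _
    set w := oracle X βstar e with hwdef
    have hm2 : 0 < (μ / 2) ^ 2 := by positivity
    have hwpos : 0 < w ⬝ᵥ w := by
      refine lt_of_lt_of_le hm2 ?_
      rw [dotProduct]
      refine le_trans ?_ (Finset.single_le_sum (f := fun i => w i * w i)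
        (fun i _ => mul_self_nonneg (w i)) (Finset.mem_univ ⟨j, hj⟩))
      rw [← sq]
      exact sq_le_sq.2 (by rw [abs_of_pos (half_pos hμ0)]; exact hw _)
    have hwle : w ⬝ᵥ w ≤ 9 / 4 * l2norm βstar ^ 2 := by
      rw [l2norm_eq_l2norm_restrict (S := supp βstar) (fun i hi => notMem_supp.1 hi), l2norm_sq,
        dotProduct, dotProduct, Finset.mul_sum]
      refine Finset.sum_le_sum fun i _ => ?_
      have h1 : |w i| ≤ 3 / 2 * |βstar i| := by
        have h1 := hu i
        have h2 := minMag_le_abs i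
        have h3 := abs_add_le (βstar i) (lsq X (supp βstar) e i)
        rw [hwdef, oracle_apply]
        linarith
      have h2 := pow_le_pow_left₀ (abs_nonneg _) h1 2
      rw [mul_pow, sq_abs, sq_abs] at h2
      linarith
    have hbpos : 0 < l2norm βstar := by
      refine lt_of_le_of_ne (l2norm_nonneg _) fun h0 => ?_
      rw [← h0] at hwle
      norm_num at hwle
      linarith
    have hlog : Real.log (w ⬝ᵥ w) - Real.log ((μ / 2) ^ 2)
        ≤ 2 * Real.log (3 * l2norm βstar / μ) := by
      rw [← Real.log_div hwpos.ne' hm2.ne']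
      have : (2 : ℝ) * Real.log (3 * l2norm βstar / μ)
          = Real.log ((3 * l2norm βstar / μ) ^ 2) := by
        rw [Real.log_pow]
        norm_num
      rw [this]
      refine Real.log_le_log (by positivity) ?_
      rw [div_le_iff₀ hm2]
      refine hwle.trans (le_of_eq ?_)
      field_simp
      norm_num
    have h1 : γ * ((8 + 4 * Real.log (supp βstar).card) / (γ * μ)
      + 1 / (κ * γ) * Real.log (3 * l2norm βstar / μ)) ≤ γ * T :=
        mul_le_mul_of_nonneg_left hT hγ.le
    have h2 : γ * ((8 + 4 * Real.log (supp βstar).card) / (γ * μ)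
      + 1 / (κ * γ) * Real.log (3 * l2norm βstar / μ))
      = 2 * Real.log (3 * l2norm βstar / μ) / (2 * κ)
        + (4 + 2 * Real.log (supp βstar).card) / (μ / 2) := by
      field_simp
      ring
    rw [h2] at h1
    refine le_trans ?_ h1
    rw [Fintype.card_coe]
    gcongr
  · rw [(hβz T ⟨hT0, le_rfl⟩).2 j hj, notMem_supp.1 hj]

/-- Euclidean error bound. -/
lemma GoodNoise.exists_l2norm_sub_le (hg : GoodNoise X βstar σ γ e) (hn : 0 < n)
    (hp : 0 < Real.log p) (hβ : βstar ≠ 0) (hσ : 0 < σ)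
    (hA1 : RestrictedStrongConvexity X (supp βstar) γ) (hκ : 0 < κ) {T : ℝ} (hT0 : 0 ≤ T)
    {β : ℝ → Fin p → ℝ} {z : ℝ → supp βstar → ℝ}
    (hz : IsFlowOn (gram X (supp βstar)) (gram X (supp βstar) *ᵥ oracle X βstar e) κ T z)
    (hβz : ∀ t ∈ Icc 0 T,
        (∀ i : supp βstar, β t i = primal κ (z t) i) ∧ ∀ j ∉ supp βstar, β t j = 0)
    {C : ℝ} (hC : 0 < C)
    (hT : 4 / (C * γ) * √(n / Real.log p)
      + 1 / (2 * κ * γ) * (1 + Real.log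
        ((n * l2norm βstar ^ 2 + 4 * σ ^ 2 * (supp βstar).card * Real.log p / γ)
          / (C ^ 2 * (supp βstar).card * Real.log p))) ≤ T) :
    ∃ τ, 0 ≤ τ ∧ τ ≤ T ∧
      l2norm (β τ - βstar)
        ≤ (C + 2 * σ / √γ) * √((supp βstar).card * Real.log p / n) := by
  have := nonempty_supp hβ
  have hγ := hA1.1
  have hn' : (0 : ℝ) < n := by exact_mod_cast hn
  set w := oracle X βstar e with hw
  set u := lsq X (supp βstar) e with hu
  set s : ℝ := ((supp βstar).card : ℝ) with hs
  have hs0 : 0 < s := by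
    have : 0 < Fintype.card (supp βstar) := Fintype.card_pos
    rw [Fintype.card_coe] at this
    rw [hs]
    exact_mod_cast this
  set r := √(s * Real.log p / n) with hr
  have hr0 : 0 < r := Real.sqrt_pos.2 (by positivity)
  have hr2 : r ^ 2 = s * Real.log p / n := Real.sq_sqrt (by positivity)
  have hsγ : 0 < √γ := Real.sqrt_pos.2 hγ
  have hunorm : l2norm u ≤ 2 * σ / √γ * r := by
    have h1 := l2norm_le_of_forall_abs_le (v := u) (by positivity) hg.on
    rw [Fintype.card_coe, ← hs, sqrt_log_div_eq hp hn hγ] at h1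
    refine h1.trans (le_of_eq ?_)
    have h2 : r = √s * √(Real.log p / n) := by
      rw [hr, ← Real.sqrt_mul hs0.le, mul_div_assoc]
    rw [h2]
    ring
  have hbs : l2norm βstar = l2norm fun i : supp βstar => βstar i :=
    l2norm_eq_l2norm_restrict fun i hi => notMem_supp.1 hi
  have hcr : 0 < C * r := by positivity
  suffices hex : ∃ t ∈ Icc 0 T, sqErr κ w (z t) ≤ (C * r) ^ 2 by
    obtain ⟨t, ht, hle⟩ := hex
    refine ⟨t, ht.1, ht.2, ?_⟩
    have h1 : l2norm (β t - βstar) = l2norm fun i : supp βstar => (β t - βstar) i :=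
      l2norm_eq_l2norm_restrict fun i hi => by
        rw [Pi.sub_apply, (hβz t ht).2 i hi, notMem_supp.1 hi, sub_zero]
    have h2 : (fun i : supp βstar => (β t - βstar) i) = (primal κ (z t) - w) + u := by
      funext i
      rw [Pi.sub_apply, (hβz t ht).1 i, Pi.add_apply, Pi.sub_apply, hw, oracle_apply]
      ring
    have h3 : l2norm (primal κ (z t) - w) ≤ C * r := by
      rw [sqErr_eq_dotProduct, ← l2norm_sq] at hle
      exact le_of_sq_le_sq hle hcr.le
    rw [h1, h2, add_mul]
    exact (l2norm_add_le _ _).trans (add_le_add h3 hunorm)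
  -- A small w is already reached at time 0. The split also guarantees w ≠ 0, so that log(w·w) is
  -- not the default value log 0 = 0.
  rcases le_or_gt (w ⬝ᵥ w) ((C * r) ^ 2) with hsmall | hbig
  · refine ⟨0, ⟨le_rfl, hT0⟩, ?_⟩
    rwa [hz.zero, sqErr_zero]
  refine hz.exists_sqErr_le hκ hA1.le_dotProduct hT0 hcr ?_
  have hc2 : 0 < (C * r) ^ 2 := by positivity
  have hwpos : 0 < w ⬝ᵥ w := hc2.trans hbig
  set A := (n * l2norm βstar ^ 2 + 4 * σ ^ 2 * s * Real.log p / γ)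
          / (C ^ 2 * s * Real.log p) with hA
  have hA0 : 0 < A := by
    have := l2norm_nonneg βstar
    positivity
  have hwle : w ⬝ᵥ w ≤ 2 * A * (C * r) ^ 2 := by
    have h1 : l2norm w ≤ l2norm βstar + 2 * σ / √γ * r := by
      rw [hw, oracle_eq_add, hbs]
      exact (l2norm_add_le _ _).trans (by gcongr)
    have h2 := pow_le_pow_left₀ (l2norm_nonneg w) h1 2
    rw [l2norm_sq] at h2
    have h3 : (2 * σ / √γ * r) ^ 2 = 4 * σ ^ 2 / γ * (s * Real.log p / n) := by
      rw [mul_pow, div_pow, Real.sq_sqrt hγ.le, hr2]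
      ring
    have h4 : 2 * A * (C * r) ^ 2 = 2 * (l2norm βstar ^ 2 + (2 * σ / √γ * r) ^ 2) := by
      rw [h3, mul_pow, hr2, hA]
      generalize l2norm βstar = q
      clear_value s
      field_simp
    rw [h4]
    refine h2.trans ?_
    exact add_sq_le
  -- The factor 2 from squaring a sum costs log 2; since log 2 < 1, the summand 1 absorbs it and
  -- leaves the strict inequality needed.
  have hlog : Real.log (w ⬝ᵥ w) - Real.log ((C * r) ^ 2) < 1 + Real.log A := by
    have h1 := Real.log_le_log hwpos hwle
    rw [Real.log_mul (by positivity) hc2.ne', Real.log_mul two_ne_zero hA0.ne'] at h1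
    linarith [Real.log_two_lt_d9]
  have hsr : √s / r = √(n / Real.log p) := by
    rw [hr, ← Real.sqrt_div hs0.le]
    congr 1
    field_simp
  have h1 : γ * (4 / (C * γ) * √(n / Real.log p) + 1 / (2 * κ * γ) * (1 + Real.log A)) ≤ γ * T :=
    mul_le_mul_of_nonneg_left hT hγ.le
  have h2 : γ * (4 / (C * γ) * √(n / Real.log p) + 1 / (2 * κ * γ) * (1 + Real.log A))
      = (1 + Real.log A) / (2 * κ) + 4 * √s / (C * r) := by
    rw [← hsr]
    field_simp
    ring
  rw [h2] at h1
  refine lt_of_lt_of_le ?_ h1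
  rw [Fintype.card_coe]
  gcongr

/-! ### Gaussian tails -/

/-- The Mills ratio bound: beyond c one may insert the factor x/c ≥ 1, after which the density has
an explicit primitive. -/
lemma gaussianReal_Ioi_le {c : ℝ} (hc : 0 < c) :
    gaussianReal 0 1 (Ioi c)
      ≤ ENNReal.ofReal ((√(2 * Real.pi))⁻¹ * (Real.exp (-c ^ 2 / 2) / c)) := by
  rw [gaussianReal_apply_eq_integral 0 one_ne_zero]
  refine ENNReal.ofReal_le_ofReal ?_
  have hint : Integrable fun x : ℝ => x * Real.exp (-x ^ 2 / 2) := by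
    refine (integrable_mul_exp_neg_mul_sq (b := 1 / 2) (by norm_num)).congr ?_
    refine Eventually.of_forall fun x => ?_
    simp only
    congr 2
    ring
  have hd : ∀ x : ℝ, HasDerivAt (fun x => -Real.exp (-x ^ 2 / 2)) (x * Real.exp (-x ^ 2 / 2)) x := by
    intro x
    have h1 : HasDerivAt (fun x : ℝ => -x ^ 2 / 2) (-(2 * x) / 2) x := by
      simpa using ((hasDerivAt_pow 2 x).neg).div_const 2
    convert! h1.exp.neg using 1
    ring
  have htend : Tendsto (fun x : ℝ => -Real.exp (-x ^ 2 / 2)) atTop (𝓝 0) := by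
    have h1 : Tendsto (fun x : ℝ => x ^ 2 / 2) atTop atTop :=
      (tendsto_pow_atTop two_ne_zero).atTop_div_const (by norm_num)
    have h2 := (Real.tendsto_exp_neg_atTop_nhds_zero.comp h1).neg
    rw [neg_zero] at h2
    refine h2.congr fun x => ?_
    simp [neg_div]
  have hval : ∫ x in Ioi c, x * Real.exp (-x ^ 2 / 2) = Real.exp (-c ^ 2 / 2) := by
    rw [integral_Ioi_of_hasDerivAt_of_tendsto (hd c).continuousAt.continuousWithinAt
      (fun x _ => hd x) hint.integrableOn htend]
    ring
  have hle : ∀ x ∈ Ioi c, gaussianPDFReal 0 1 x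
      ≤ (√(2 * Real.pi))⁻¹ / c * (x * Real.exp (-x ^ 2 / 2)) := by
    intro x hx
    have h1 : gaussianPDFReal 0 1 x = (√(2 * Real.pi))⁻¹ * Real.exp (-x ^ 2 / 2) := by
      simp [gaussianPDFReal]
    have h2 : 1 ≤ x / c := (one_le_div hc).2 (le_of_lt hx)
    rw [h1]
    calc (√(2 * Real.pi))⁻¹ * Real.exp (-x ^ 2 / 2)
        ≤ (√(2 * Real.pi))⁻¹ * Real.exp (-x ^ 2 / 2) * (x / c) :=
          le_mul_of_one_le_right (by positivity) h2
      _ = _ := by ring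
  refine (setIntegral_mono_on (integrable_gaussianPDFReal 0 1).integrableOn
    (hint.const_mul _).integrableOn measurableSet_Ioi hle).trans (le_of_eq ?_)
  rw [integral_const_mul, hval]
  ring

lemma gaussianReal_lt_abs_le {c : ℝ} (hc : 0 < c) (v : ℝ≥0) :
    gaussianReal 0 v {x | c * √(v : ℝ) < |x|}
      ≤ ENNReal.ofReal (2 * ((√(2 * Real.pi))⁻¹ * (Real.exp (-c ^ 2 / 2) / c))) := by
  -- Scaling a standard Gaussian also covers v = 0. The event is a strict inequality, so it is then
  -- empty after pulling back.
  have hmap : gaussianReal 0 v = (gaussianReal 0 1).map (√(v : ℝ) * ·) := by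
    rw [gaussianReal_map_const_mul, mul_zero, mul_one]
    congr 1
    exact NNReal.eq (Real.sq_sqrt v.2).symm
  have hmeas : MeasurableSet {x : ℝ | c * √(v : ℝ) < |x|} :=
    measurableSet_lt measurable_const measurable_norm
  rw [hmap, Measure.map_apply (by fun_prop) hmeas]
  have hsub : (√(v : ℝ) * ·) ⁻¹' {x : ℝ | c * √(v : ℝ) < |x|} ⊆ Ioi c ∪ Iio (-c) := by
    intro x hx
    rw [mem_preimage, mem_ofPred_eq, abs_mul, abs_of_nonneg (Real.sqrt_nonneg _), mul_comm c] at hx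
    have := lt_of_mul_lt_mul_left hx (Real.sqrt_nonneg _)
    rcases lt_abs.1 this with h | h
    · exact Or.inl h
    · exact Or.inr (by rw [mem_Iio]; linarith)
  have hneg : gaussianReal 0 1 (Iio (-c)) = gaussianReal 0 1 (Ioi c) := by
    have h1 : (gaussianReal 0 1).map (fun x => -x) = gaussianReal 0 1 := by
      rw [gaussianReal_map_neg, neg_zero]
    conv_lhs => rw [← h1]
    rw [Measure.map_apply (by fun_prop) measurableSet_Iio]
    congr 1
    ext x
    simp
  refine (measure_mono hsub).trans ((measure_union_le _ _).trans ?_)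
  rw [hneg, ← two_mul, ENNReal.ofReal_mul (by norm_num)]
  have h2 : ENNReal.ofReal 2 = 2 := by simp
  rw [h2]
  exact mul_le_mul_right (gaussianReal_Ioi_le hc) _

/-- White noise with variance `σ²`. -/
noncomputable abbrev noise (n : ℕ) (σ : ℝ) : Measure (Fin n → ℝ) :=
  Measure.pi fun _ : Fin n => gaussianReal 0 (σ ^ 2).toNNReal

lemma map_dotProduct_noise {n : ℕ} (σ : ℝ) (a : Fin n → ℝ) :
    (noise n σ).map (fun e => a ⬝ᵥ e)
      = gaussianReal 0 ((l2norm a * σ) ^ 2).toNNReal := by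
  have hind : iIndepFun (fun (i : Fin n) (e : Fin n → ℝ) => a i * e i) (noise n σ) :=
    iIndepFun_pi (X := fun i x => a i * x) fun i => by fun_prop
  have hid : ∀ i : Fin n, HasLaw (fun e : Fin n → ℝ => e i)
      (gaussianReal 0 (σ ^ 2).toNNReal) (noise n σ) := fun i =>
    ⟨(measurable_pi_apply i).aemeasurable, (measurePreserving_eval _ i).map_eq⟩
  have hgauss : ∀ i : Fin n, HasGaussianLaw (fun e : Fin n → ℝ => a i * e i) (noise n σ) :=
    fun i => (hid i).hasGaussianLaw.fun_smul (a i)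
  have hsum := hind.hasGaussianLaw_fun_sum hgauss
  have hmem : ∀ i : Fin n, MemLp (fun x : ℝ => a i * x) 2
      (gaussianReal 0 (σ ^ 2).toNNReal) := fun i =>
    (memLp_id_gaussianReal' 2 (by simp)).const_mul (a i)
  have hmean : ∫ e, ∑ i, a i * e i ∂noise n σ = 0 := by
    rw [integral_finsetSum _ fun i _ => (hgauss i).integrable]
    refine Finset.sum_eq_zero fun i _ => ?_
    rw [integral_const_mul]
    have := (hid i).integral_eq
    simp only [integral_id_gaussianReal] at this
    rw [this, mul_zero]
  have hvar : Var[fun e => ∑ i, a i * e i; noise n σ] = (l2norm a * σ) ^ 2 := by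
    have h1 := variance_sum_pi hmem
    have h2 : (∑ i, fun e : Fin n → ℝ => a i * e i) = fun e => ∑ i, a i * e i := by
      funext e
      simp
    rw [h2] at h1
    rw [h1, mul_pow, l2norm_sq, dotProduct, Finset.sum_mul]
    refine Finset.sum_congr rfl fun i _ => ?_
    have h3 := variance_const_mul (a i) id (gaussianReal 0 (σ ^ 2).toNNReal)
    rw [variance_id_gaussianReal, Real.coe_toNNReal _ (sq_nonneg σ)] at h3
    rw [← sq]
    exact h3
  have := hsum.map_eq_gaussianReal
  rw [hmean, hvar] at this
  exact this

lemma noise_lt_abs_dotProduct_le {n N : ℕ} (hN : 2 ≤ N) {σ d : ℝ} (hσ : 0 < σ) {a : Fin n → ℝ}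
    (ha : l2norm a ≤ d) :
    noise n σ {e | 2 * σ * √(Real.log N) * d < |a ⬝ᵥ e|}
      ≤ ENNReal.ofReal (1 / (N ^ 2 * √(2 * Real.pi * Real.log N))) := by
  have hN0 : (0 : ℝ) < N := by exact_mod_cast (by omega : 0 < N)
  have hL : 0 < Real.log N := Real.log_pos (by exact_mod_cast (by omega : 1 < N))
  have hsL : 0 < √(Real.log N) := Real.sqrt_pos.2 hL
  have hmeas : MeasurableSet {x : ℝ | 2 * √(Real.log N)
      * √((((l2norm a * σ) ^ 2).toNNReal : ℝ≥0) : ℝ) < |x|} :=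
    measurableSet_lt measurable_const measurable_norm
  have hdot : Measurable fun e : Fin n → ℝ => a ⬝ᵥ e := by
    simp only [dotProduct]
    fun_prop
  have h := gaussianReal_lt_abs_le (c := 2 * √(Real.log N)) (by positivity)
    ((l2norm a * σ) ^ 2).toNNReal
  rw [← map_dotProduct_noise, Measure.map_apply hdot hmeas] at h
  refine (measure_mono ?_).trans (h.trans (ENNReal.ofReal_le_ofReal (le_of_eq ?_)))
  · intro e he
    rw [mem_preimage, mem_ofPred_eq, Real.coe_toNNReal _ (sq_nonneg _),
      Real.sqrt_sq (mul_nonneg (l2norm_nonneg a) hσ.le)]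
    refine lt_of_le_of_lt ?_ he
    calc 2 * √(Real.log N) * (l2norm a * σ) = 2 * σ * √(Real.log N) * l2norm a := by ring
      _ ≤ 2 * σ * √(Real.log N) * d := by gcongr
  -- The factor 2 in the threshold turns the exponential into N⁻², enough for a union over N
  -- functionals.
  · have h1 : -(2 * √(Real.log N)) ^ 2 / 2 = -(2 * Real.log N) := by
      rw [mul_pow, Real.sq_sqrt hL.le]
      ring
    have h2 : Real.exp (2 * Real.log N) = (N : ℝ) ^ 2 := by
      rw [mul_comm, Real.exp_mul, Real.exp_log hN0]
      norm_num
    rw [h1, Real.exp_neg, h2, Real.sqrt_mul (by positivity : (0 : ℝ) ≤ 2 * Real.pi)]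
    field_simp

/-! ### Linear functionals of the noise -/

section Functionals

variable {n p : ℕ} {X : Matrix (Fin n) (Fin p) ℝ} {S : Finset (Fin p)} {γ : ℝ}

lemma adj_cols_mulVec (e : Fin n → ℝ) (v : S → ℝ) :
    v ⬝ᵥ adj (cols X S) *ᵥ e = (1 / n : ℝ) * ((cols X S *ᵥ v) ⬝ᵥ e) := by
  rw [adj, Matrix.smul_mulVec, dotProduct_smul, Matrix.dotProduct_mulVec, Matrix.vecMul_transpose,
    smul_eq_mul]

lemma cols_mulVec_dotProduct_resid (hn : 0 < n) (h : IsUnit (gram X S).det) (e : Fin n → ℝ)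
    (v : S → ℝ) : (cols X S *ᵥ v) ⬝ᵥ resid X S e = 0 := by
  have h1 := adj_cols_mulVec (X := X) (resid X S e) v
  have hn' : (n : ℝ) ≠ 0 := by exact_mod_cast hn.ne'
  rw [adj_mulVec_resid h, dotProduct_zero] at h1
  have := (mul_eq_zero.1 h1.symm).resolve_left (by positivity)
  exact this

lemma resid_dotProduct_resid (hn : 0 < n) (h : IsUnit (gram X S).det) (x e : Fin n → ℝ) :
    resid X S x ⬝ᵥ resid X S e = x ⬝ᵥ resid X S e := by
  conv_lhs => rw [resid, sub_dotProduct, cols_mulVec_dotProduct_resid hn h, sub_zero]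

/-- Taking residuals is an orthogonal projection, hence symmetric; it can be moved from the noise
onto a fixed column. -/
lemma dotProduct_resid (hn : 0 < n) (h : IsUnit (gram X S).det) (x e : Fin n → ℝ) :
    x ⬝ᵥ resid X S e = resid X S x ⬝ᵥ e := by
  rw [← resid_dotProduct_resid hn h, dotProduct_comm, resid_dotProduct_resid hn h,
    dotProduct_comm]

lemma l2norm_resid_le (hn : 0 < n) (h : IsUnit (gram X S).det) (x : Fin n → ℝ) :
    l2norm (resid X S x) ≤ l2norm x := by
  refine le_of_sq_le_sq ?_ (l2norm_nonneg x)
  have h1 : x = resid X S x + cols X S *ᵥ lsq X S x := by rw [resid, sub_add_cancel]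
  have h2 := cols_mulVec_dotProduct_resid hn h x (lsq X S x)
  have h3 := dotProduct_self_nonneg' (cols X S *ᵥ lsq X S x)
  rw [l2norm_sq, l2norm_sq]
  conv_rhs => rw [h1]
  rw [add_dotProduct, dotProduct_add, dotProduct_add, dotProduct_comm (resid X S x) (cols X S *ᵥ _),
    h2]
  linarith

lemma l2norm_smul (c : ℝ) {ι : Type*} [Fintype ι] (v : ι → ℝ) :
    l2norm (c • v) = |c| * l2norm v := by
  rw [l2norm, WithLp.toLp_smul, norm_smul, Real.norm_eq_abs, l2norm]

/-- Each correlation of the residual with a column is a short functional of the noise. -/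
lemma exists_resid_functional (hn : 0 < n) (h : IsUnit (gram X S).det) (j : Fin p) :
    ∃ a : Fin n → ℝ, l2norm a ≤ l2norm (fun i => X i j) / √n / √n ∧
      ∀ e, (adj X *ᵥ resid X S e) j = a ⬝ᵥ e := by
  have hn' : (0 : ℝ) < n := by exact_mod_cast hn
  refine ⟨(1 / n : ℝ) • resid X S fun i => X i j, ?_, fun e => ?_⟩
  · rw [l2norm_smul, abs_of_pos (by positivity), div_div, Real.mul_self_sqrt hn'.le,
      div_mul_eq_mul_div, one_mul]
    gcongr
    exact l2norm_resid_le hn h _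
  · rw [smul_dotProduct, ← dotProduct_resid hn h, adj, Matrix.smul_mulVec]
    rfl

/-- Each least squares coefficient is a short functional of the noise. -/
lemma exists_lsq_functional (hn : 0 < n) (hA1 : RestrictedStrongConvexity X S γ) (i : S) :
    ∃ a : Fin n → ℝ, l2norm a ≤ 1 / √(γ * n) ∧ ∀ e, lsq X S e i = a ⬝ᵥ e := by
  classical
  have hn' : (0 : ℝ) < n := by exact_mod_cast hn
  have hγ := hA1.1
  have hu := hA1.isUnit_det
  set h := (gram X S)⁻¹ *ᵥ Pi.single i 1 with hdef
  have hH : gram X S *ᵥ h = Pi.single i 1 := by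
    rw [hdef, Matrix.mulVec_mulVec, Matrix.mul_nonsing_inv _ hu, Matrix.one_mulVec]
  have hquad : h ⬝ᵥ gram X S *ᵥ h = h i := by rw [hH, dotProduct_single_one]
  -- With h = H⁻¹e_i, the functional (1/n)X_S h has squared norm hᵀHh/n = h_i/n. Strong convexity
  -- applied to h itself gives h_i ≤ 1/γ.
  have hi : γ * h i ^ 2 ≤ h i := by
    rw [← hquad]
    refine le_trans ?_ (hA1.le_dotProduct h)
    rw [hquad, sq]
    gcongr
    exact Finset.single_le_sum (f := fun i => h i * h i) (fun i _ => mul_self_nonneg (h i))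
      (Finset.mem_univ i)
  have hi0 : 0 ≤ h i := le_trans (by positivity) hi
  have hi1 : h i ≤ 1 / γ := by
    rw [le_div_iff₀ hγ]
    rcases hi0.eq_or_lt with h0 | h0
    · rw [← h0]; simp
    · have : h i * (h i * γ) ≤ h i * 1 := by linarith
      exact le_of_mul_le_mul_left this h0
  refine ⟨(1 / n : ℝ) • cols X S *ᵥ h, ?_, fun e => ?_⟩
  · refine le_of_sq_le_sq ?_ (by positivity)
    rw [l2norm_smul, mul_pow, sq_abs, l2norm_sq, div_pow, one_pow, div_pow, one_pow,
      Real.sq_sqrt (by positivity)]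
    have h1 := dotProduct_gram_mulVec (X := X) h
    rw [hquad, eq_div_iff hn'.ne'] at h1
    rw [← h1]
    calc 1 / (n : ℝ) ^ 2 * (h i * n) = 1 / n * h i := by field_simp
      _ ≤ 1 / n * (1 / γ) := by gcongr
      _ = 1 / (γ * n) := by field_simp
  · rw [smul_dotProduct, smul_eq_mul, ← adj_cols_mulVec]
    have h1 : adj (cols X S) *ᵥ e = gram X S *ᵥ lsq X S e := by
      rw [lsq, Matrix.mulVec_mulVec, Matrix.mul_nonsing_inv _ hu, Matrix.one_mulVec]
    rw [h1, Matrix.dotProduct_mulVec, ← Matrix.mulVec_transpose, gram_isSymm.eq, hH,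
      single_one_dotProduct]

/-- The fitted noise has at most `min |S| n` coordinates, each a unit functional of the noise. -/
lemma exists_fit_functionals (hn : 0 < n) (h : IsUnit (gram X S).det) :
    ∃ (d : ℕ) (u : Fin d → Fin n → ℝ), d ≤ S.card ∧ d ≤ n ∧ (∀ k, l2norm (u k) ≤ 1) ∧
      ∀ e, l2norm (cols X S *ᵥ lsq X S e) ^ 2 = ∑ k, (u k ⬝ᵥ e) ^ 2 := by
  let L : (S → ℝ) →ₗ[ℝ] EuclideanSpace ℝ (Fin n) :=
    (WithLp.linearEquiv 2 ℝ (Fin n → ℝ)).symm.toLinearMap ∘ₗ Matrix.mulVecLin (cols X S)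
  have hL : ∀ v, L v = WithLp.toLp 2 (cols X S *ᵥ v) := fun v => rfl
  let K := LinearMap.range L
  let b := stdOrthonormalBasis ℝ K
  refine ⟨Module.finrank ℝ K, fun k i => (b k : EuclideanSpace ℝ (Fin n)) i, ?_, ?_, ?_, ?_⟩
  · have := LinearMap.finrank_range_le L
    simpa using this
  · have := Submodule.finrank_le K
    simpa using this
  · intro k
    exact (b.norm_eq_one k).le
  · intro e
    set x : K := ⟨L (lsq X S e), LinearMap.mem_range_self L _⟩ with hx
    have h1 : l2norm (cols X S *ᵥ lsq X S e) = ‖x‖ := rfl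
    rw [h1, ← b.sum_sq_norm_inner_right x]
    refine Finset.sum_congr rfl fun k _ => ?_
    obtain ⟨v, hv⟩ := (b k).2
    have h2 : inner ℝ (b k) x = (cols X S *ᵥ v) ⬝ᵥ (cols X S *ᵥ lsq X S e) := by
      have hxv : (x : EuclideanSpace ℝ (Fin n)) = WithLp.toLp 2 (cols X S *ᵥ lsq X S e) := rfl
      rw [Submodule.coe_inner, ← hv, hL, hxv, EuclideanSpace.inner_eq_star_dotProduct]
      simp [dotProduct_comm]
    have h3 : (fun i => (b k : EuclideanSpace ℝ (Fin n)) i) = cols X S *ᵥ v := by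
      rw [← hv, hL]
    -- The fitted noise and e differ by the residual, which is orthogonal to the column space; each
    -- coordinate is therefore linear in e itself.
    have h4 : (cols X S *ᵥ v) ⬝ᵥ (cols X S *ᵥ lsq X S e) = (cols X S *ᵥ v) ⬝ᵥ e := by
      have := cols_mulVec_dotProduct_resid hn h e v
      rw [resid, dotProduct_sub] at this
      linarith
    change _ = ((fun i => (b k : EuclideanSpace ℝ (Fin n)) i) ⬝ᵥ e) ^ 2
    rw [h2, h3, h4, Real.norm_eq_abs, sq_abs]

end Functionals

/-! ### The good event -/

lemma exists_goodNoise_event {n p : ℕ} (hn : 2 ≤ n) (hp : 2 ≤ p)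
    (X : Matrix (Fin n) (Fin p) ℝ) (βstar : Fin p → ℝ) {σ γ : ℝ} (hσ : 0 < σ)
    (hA1 : RestrictedStrongConvexity X (supp βstar) γ) :
    ∃ G : Set (Fin n → ℝ), MeasurableSet G ∧ (∀ e ∈ G, GoodNoise X βstar σ γ e) ∧
      1 - 2 / (p * √(Real.pi * Real.log p)) - 1 / (n * √(Real.pi * Real.log n))
        ≤ (noise n σ).real G := by
  classical
  have hn0 : 0 < n := by omega
  have hn' : (0 : ℝ) < n := by exact_mod_cast hn0
  have hp' : (0 : ℝ) < p := by exact_mod_cast (by omega : 0 < p)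
  have hLn : 0 < Real.log n := Real.log_pos (by exact_mod_cast (by omega : 1 < n))
  have hLp : 0 < Real.log p := Real.log_pos (by exact_mod_cast (by omega : 1 < p))
  have hγ := hA1.1
  have hu := hA1.isUnit_det
  choose a ha hae using fun j => exists_resid_functional hn0 hu j
  choose l hl hle using fun i => exists_lsq_functional hn0 hA1 i
  obtain ⟨d, u, hds, hdn, hu1, hue⟩ := exists_fit_functionals hn0 hu
  have hM : ∀ j ∉ supp βstar, l2norm (fun i => X i j) / √n ≤ maxOffCol X βstar := fun j hj =>
    le_ciSup (f := fun j : ((supp βstar)ᶜ : Finset (Fin p)) => l2norm (fun i => X i j) / √(n : ℝ))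
      (Set.finite_range _).bddAbove ⟨j, Finset.mem_compl.2 hj⟩
  -- Each coordinate contributes one functional, least squares on S and residual correlation off S,
  -- so one union bound over p events covers both.
  let f : Fin p → Fin n → ℝ := fun j => if hj : j ∈ supp βstar then l ⟨j, hj⟩ else a j
  let D : Fin p → ℝ := fun j =>
    if j ∈ supp βstar then 1 / √(γ * n) else maxOffCol X βstar / √n
  have hfD : ∀ j, l2norm (f j) ≤ D j := by
    intro j
    by_cases hj : j ∈ supp βstar
    · simp only [f, D, dif_pos hj, if_pos hj]
      exact hl _
    · simp only [f, D, dif_neg hj, if_neg hj]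
      refine (ha j).trans ?_
      gcongr
      exact hM j hj
  let bad₁ : Set (Fin n → ℝ) := ⋃ j, {e | 2 * σ * √(Real.log p) * D j < |f j ⬝ᵥ e|}
  let bad₂ : Set (Fin n → ℝ) := ⋃ k, {e | 2 * σ * √(Real.log n) * 1 < |u k ⬝ᵥ e|}
  have hmeas : ∀ (c : ℝ) (g : Fin n → ℝ), MeasurableSet {e : Fin n → ℝ | c < |g ⬝ᵥ e|} := by
    intro c g
    refine measurableSet_lt measurable_const ?_
    have : Measurable fun e : Fin n → ℝ => g ⬝ᵥ e := by
      simp only [dotProduct]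
      fun_prop
    exact measurable_norm.comp this
  have hm₁ : MeasurableSet bad₁ := MeasurableSet.iUnion fun j => hmeas _ _
  have hm₂ : MeasurableSet bad₂ := MeasurableSet.iUnion fun k => hmeas _ _
  have hb₁ : noise n σ bad₁ ≤ ENNReal.ofReal (1 / (p * √(2 * Real.pi * Real.log p))) := by
    refine (measure_iUnion_fintype_le _ _).trans ?_
    refine (Finset.sum_le_sum fun j _ => noise_lt_abs_dotProduct_le hp hσ (hfD j)).trans ?_
    rw [Finset.sum_const, Finset.card_univ, Fintype.card_fin, nsmul_eq_mul,
      ← ENNReal.ofReal_natCast, ← ENNReal.ofReal_mul (Nat.cast_nonneg _)]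
    refine ENNReal.ofReal_le_ofReal (le_of_eq ?_)
    field_simp
  have hb₂ : noise n σ bad₂ ≤ ENNReal.ofReal (1 / (n * √(2 * Real.pi * Real.log n))) := by
    refine (measure_iUnion_fintype_le _ _).trans ?_
    refine (Finset.sum_le_sum fun k _ => noise_lt_abs_dotProduct_le hn hσ (hu1 k)).trans ?_
    rw [Finset.sum_const, Finset.card_univ, Fintype.card_fin, nsmul_eq_mul,
      ← ENNReal.ofReal_natCast, ← ENNReal.ofReal_mul (Nat.cast_nonneg _)]
    refine ENNReal.ofReal_le_ofReal ?_
    -- Here d ≤ n keeps the union bound of order 1/n; the other bound d ≤ |S| gives the size of the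
    -- fitted noise.
    calc (d : ℝ) * (1 / (n ^ 2 * √(2 * Real.pi * Real.log n)))
        ≤ n * (1 / (n ^ 2 * √(2 * Real.pi * Real.log n))) := by
          gcongr
      _ = _ := by field_simp
  have hsqrt : ∀ {L : ℝ}, 0 < L → √(Real.pi * L) ≤ √(2 * Real.pi * L) := fun hL =>
    Real.sqrt_le_sqrt (by nlinarith [mul_pos Real.pi_pos hL])
  refine ⟨(bad₁ ∪ bad₂)ᶜ, (hm₁.union hm₂).compl, fun e he => ?_, ?_⟩
  · rw [compl_union, mem_inter_iff, mem_compl_iff, mem_compl_iff, mem_iUnion, mem_iUnion] at he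
    have h1 : ∀ j, |f j ⬝ᵥ e| ≤ 2 * σ * √(Real.log p) * D j := fun j => by
      by_contra hlt
      exact he.1 ⟨j, not_le.1 hlt⟩
    have h2 : ∀ k, |u k ⬝ᵥ e| ≤ 2 * σ * √(Real.log n) := fun k => by
      by_contra hlt
      exact he.2 ⟨k, by rw [mem_ofPred_eq, mul_one]; exact not_le.1 hlt⟩
    refine ⟨fun j hj => ?_, fun i => ?_, ?_⟩
    · have := h1 j
      simp only [f, D, dif_neg hj, if_neg hj] at this
      rw [hae]
      refine this.trans (le_of_eq ?_)
      rw [Real.sqrt_div hLp.le]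
      ring
    · have := h1 i
      simp only [f, D, dif_pos i.2, if_pos i.2] at this
      rw [hle]
      refine this.trans (le_of_eq ?_)
      rw [Real.sqrt_div hLp.le]
      ring
    · refine le_of_sq_le_sq ?_ (by positivity)
      rw [hue, mul_pow, Real.sq_sqrt (by positivity)]
      calc ∑ k, (u k ⬝ᵥ e) ^ 2 ≤ ∑ _k : Fin d, (2 * σ * √(Real.log n)) ^ 2 :=
            Finset.sum_le_sum fun k _ =>
              sq_le_sq.2 (by rw [abs_of_nonneg (by positivity : 0 ≤ 2 * σ * √(Real.log n))]
                             exact h2 k)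
        _ = d * ((2 * σ) ^ 2 * Real.log n) := by
            rw [Finset.sum_const, Finset.card_univ, Fintype.card_fin, nsmul_eq_mul, mul_pow,
              Real.sq_sqrt hLn.le]
        _ ≤ (supp βstar).card * ((2 * σ) ^ 2 * Real.log n) := by gcongr
        _ = _ := by ring
  · have h1 : (noise n σ).real (bad₁ ∪ bad₂) ≤ 1 / (p * √(2 * Real.pi * Real.log p))
        + 1 / (n * √(2 * Real.pi * Real.log n)) := by
      refine (measureReal_union_le _ _).trans (add_le_add ?_ ?_)
      · exact ENNReal.toReal_le_of_le_ofReal (by positivity) hb₁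
      · exact ENNReal.toReal_le_of_le_ofReal (by positivity) hb₂
    have h2 : 1 / (p * √(2 * Real.pi * Real.log p)) ≤ 2 / (p * √(Real.pi * Real.log p)) := by
      have := Real.sqrt_pos.2 (mul_pos Real.pi_pos hLp)
      have := hsqrt hLp
      gcongr
      norm_num
    have h3 : 1 / (n * √(2 * Real.pi * Real.log n)) ≤ 1 / (n * √(Real.pi * Real.log n)) := by
      have := Real.sqrt_pos.2 (mul_pos Real.pi_pos hLn)
      have := hsqrt hLn
      gcongr
    rw [probReal_compl_eq_one_sub (hm₁.union hm₂)]
    linarith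

end LBISS

/-! ### Assembly of the theorem. -/

theorem mainTheorem2 {n p : ℕ} (hn : 2 ≤ n)
    (X : Matrix (Fin n) (Fin p) ℝ) (βstar : Fin p → ℝ) (hβ : βstar ≠ 0)
    (hT : ∃ j, βstar j = 0 ∧ ∃ i, X i j ≠ 0)
    {Ω : Type*} [MeasurableSpace Ω] (P : Measure Ω) [IsProbabilityMeasure P]
    (ε : Ω → Fin n → ℝ) (σ : ℝ) (hσ : 0 < σ)
    (hε : HasLaw ε (Measure.pi fun _ : Fin n => gaussianReal 0 (σ ^ 2).toNNReal) P)
    (γ η κ : ℝ) (hκ : 0 < κ)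
    (hA1 : RestrictedStrongConvexity X (supp βstar) γ)
    (hA2 : Irrepresentable X (supp βstar) η)
    (hB : constB X βstar σ γ ≤ κ * η) :
    (∀ ω, ∃ ρ β : ℝ → Fin p → ℝ, IsPath X (X *ᵥ βstar + ε ω) κ ρ β) ∧
    ∃ E : Set Ω, MeasurableSet E ∧
      1 - 2 / (p * √(Real.pi * Real.log p)) - 1 / (n * √(Real.pi * Real.log n)) ≤ P.real E ∧
      ∀ ω ∈ E, ∀ ρ β : ℝ → Fin p → ℝ, IsPath X (X *ᵥ βstar + ε ω) κ ρ β →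
        -- A. no false positives
        (∀ t, 0 ≤ t → t ≤ tauBar X βstar σ γ η κ → supp (β t) ⊆ supp βstar) ∧
        -- B. sign consistency of the mean path
        (0 < tauBar X βstar σ γ η κ →
          constC1 X βstar σ γ η κ / tauBar X βstar σ γ η κ < minMag βstar →
          SameSign (meanPath β (tauBar X βstar σ γ η κ)) βstar) ∧
        -- C. sign consistency of the path
        (4 * σ / √γ * √(Real.log p / n) ≤ minMag βstar →
          (8 + 4 * Real.log (supp βstar).card) / (γ * minMag βstar)
              + 1 / (κ * γ) * Real.log (3 * l2norm βstar / minMag βstar)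
            ≤ tauBar X βstar σ γ η κ →
          SameSign (β (tauBar X βstar σ γ η κ)) βstar) ∧
        -- D. Euclidean error bound
        (∀ C : ℝ, 0 < C →
          4 / (C * γ) * √(n / Real.log p)
              + 1 / (2 * κ * γ) * (1 + Real.log
                ((n * l2norm βstar ^ 2 + 4 * σ ^ 2 * (supp βstar).card * Real.log p / γ)
                  / (C ^ 2 * (supp βstar).card * Real.log p)))
            ≤ tauBar X βstar σ γ η κ →
          ∃ τ, 0 ≤ τ ∧ τ ≤ tauBar X βstar σ γ η κ ∧
            l2norm (β τ - βstar)
              ≤ (C + 2 * σ / √γ) * √((supp βstar).card * Real.log p / n)) := by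
  obtain ⟨j₀, hj₀, i₀, hi₀⟩ := hT
  obtain ⟨j₁, hj₁⟩ := Function.ne_iff.1 hβ
  have hn0 : 0 < n := by omega
  have hn' : (0 : ℝ) < n := by exact_mod_cast hn0
  -- β* has both a zero and a nonzero coordinate, so there are at least two; hence log p > 0.
  have hp : 2 ≤ p := by
    have : Nontrivial (Fin p) := ⟨j₀, j₁, fun h => hj₁ (by rw [← h, hj₀, Pi.zero_apply])⟩
    exact Fin.nontrivial_iff_two_le.1 this
  have hLp : 0 < Real.log p := Real.log_pos (by exact_mod_cast (by omega : 1 < p))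
  have hM : 0 < maxOffCol X βstar := by
    refine lt_of_lt_of_le ?_ (le_ciSup
      (f := fun j : ((supp βstar)ᶜ : Finset (Fin p)) => l2norm (fun i => X i j) / √(n : ℝ))
      (Set.finite_range _).bddAbove ⟨j₀, Finset.mem_compl.2 (notMem_supp.2 hj₀)⟩)
    exact div_pos ((abs_pos.2 hi₀).trans_le (abs_le_l2norm (fun i => X i j₀) i₀))
      (Real.sqrt_pos.2 hn')
  refine ⟨fun ω => exists_isPath X _ hκ, ?_⟩
  obtain ⟨G, hGm, hG, hGP⟩ := exists_goodNoise_event hn hp X βstar hσ hA1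
  -- As ε is only almost everywhere measurable, the preimage of G is only null measurable; E is a
  -- measurable subset of the same probability.
  obtain ⟨E, hEG, hEm, hEae⟩ :=
    (hε.aemeasurable.nullMeasurable hGm).exists_measurable_subset_ae_eq
  refine ⟨E, hEm, ?_, fun ω hω ρ β hpath => ?_⟩
  · rw [measureReal_congr hEae, ← map_measureReal_apply_of_aemeasurable hε.aemeasurable hGm,
      hε.map_eq]
    exact hGP
  · have hg := hG _ (hEG hω)
    have hτ := tauBar_nonneg (X := X) (βstar := βstar) hκ hA2.1 hσ hM hB
    obtain ⟨z, hz, hβz⟩ := hg.exists_restricted hn0 hLp hβ hσ hM hA1 hA2 hκ hpath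
    refine ⟨fun t ht ht' i hi => ?_, fun hpos hmin => ?_, fun hmin hTC => ?_, fun C hC hTD => ?_⟩
    · by_contra hi'
      exact mem_supp.1 hi ((hβz t ⟨ht, ht'⟩).2 i hi')
    · exact hg.sameSign_meanPath hn0 hLp hβ hσ hM hA1 hA2 hκ hz hβz hpath.beta_continuous hpos hmin
    · exact hg.sameSign hn0 hLp hβ hA1 hκ hτ hz hβz hmin hTC
    · exact hg.exists_l2norm_sub_le hn0 hLp hβ hσ hA1 hκ hτ hz hβz hC hTD
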